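/- Let $(\mathcal C,\otimes,I,\Phi)$ be a closed braided monoidal category with equalizers and coequalizers, with inner homs $[A,-]$ right adjoint to $A\otimes -$. Let $H\in\mathcal C$ be a Hopf algebra that is flat, i.e. $H\otimes -$ preserves equalizers. Suppose that the braiding is $H$-linear: for all left $H$-modules $M,N$ the morphism $\Phi_{M,N}\colon M\otimes N\to N\otimes M$ is $H$-linear for the diagonal actions. Then the category ${}_H\mathcal C$ of left $H$-modules is braided monoidal with the diagonal action and the braiding $\Phi$; an $H$-module algebra is an algebra in ${}_H\mathcal C$. An algebra $A$ in a braided monoidal category is *Azumaya* if it is faithfully projective, that is, it has a dual $P=[A,I]$ (so that $[A,Y]=P\otimes Y$) and evaluation induces an isomorphism $A\otimes_{[A,A]}[A,I]\cong I$, and if the two canonical morphisms $A\otimes\overline A\to[A,A]$, $a\otimes b\mapsto(c\mapsto a(cb))$ (with $b$ passing $c$ by $\Phi$), and $\overline A\otimes A\to[A,A]$, $a\otimes b\mapsto(c\mapsto(ac)b)$ (with $c$ passing $a$ by $\Phi$), are isomorphisms. An *$H$-Azumaya algebra* is an Azumaya algebra in ${}_H\mathcal C$. An *$H$-Galois object*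 is a right $H$-comodule algebra $T$ in $\mathcal C$ such that $T\otimes -$ preserves and reflects equalizers and the morphism $T\otimes T\to T\otimes H$, $x\otimes y\mapsto xy_{(0)}\otimes y_{(1)}$, is an isomorphism; isomorphisms of $H$-Galois objects are isomorphisms of $H$-comodule algebras. For an $H$-module algebra $A$, the smash product $A\# H$ is $A\otimes H$ with multiplication $(a\# h)(b\# k)=a(h_{(1)}b)\# h_{(2)}k$ (with $h_{(2)}$ passing $b$ by $\Phi$), unit $1\#1$ and right $H$-coaction $A\otimes\Delta$. For $A$ $H$-Azumaya, $(A\# H)^A$ is the equalizer of the two morphisms $A\# H\to[A,A\# H]$ adjoint to $a\otimes m\mapsto (a\#1)m$ and to $A\otimes (A\# H)\xrightarrow{\Phi}(A\# H)\otimes A\to A\# H$, $m\otimes a\mapsto m(a\#1)$; it is an $H$-comodule subalgebra of $A\# H$. For right $H$-comodule algebras $S,T$, the cotensor product $S\,\Box_H\,T$ is the equalizer of $\rho_S\otimes T$ and $S\otimes\lambda_T\colon S\otimes T\to S\otimes H\otimes T$, where $\lambda_T=\Phi_{T,H}\circ\rho_T$; it is a subalgebra of $S\otimes T$, and an $H$-comodule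 algebra through $S\otimes\rho_T$. (The $H$-linearity of the braiding makes $H$ cocommutative and $\Phi_{H,X}^{-1}=\Phi_{X,H}$ for all $X$.) Suppose in addition that $\Phi_{T,X}=\Phi_{X,T}^{-1}$ for every $H$-Galois object $T$ and every $X\in\mathcal C$. If $A$ and $B$ are $H$-Azumaya algebras, then $[(A\otimes B)\# H]^{A\otimes B}$ and $(A\# H)^A\,\Box_H\,(B\# H)^B$ are $H$-Galois objects, and there is an isomorphism of $H$-Galois objects $$[(A\otimes B)\# H]^{A\otimes B}\;\cong\;(A\# H)^A\,\Box_H\,(B\# H)^B .$$ Here $A\otimes B$ is the tensor product algebra in ${}_H\mathcal C$. -/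

import Mathlib

open CategoryTheory MonoidalCategory Limits
open scoped MonObj ComonObj

universe v u

namespace BraidedHopf

variable {C : Type u} [Category.{v} C] [MonoidalCategory C] [BraidedCategory C]

/-! ### The category of left `H`-modules -/

section Modules

variable {H : C} [BimonObj H]

instance : IsMonHom (Δ[H]) where
  one_hom := BimonObj.one_comul H
  mul_hom := by rw [BimonObj.mul_comul]; rfl

instance : IsMonHom (ε[H]) where
  one_hom := by rw [BimonObj.one_counit]; rfl
  mul_hom := by rw [BimonObj.mul_counit]; rfl

/-- The action `H ⊗ M ⟶ M` of a left `H`-module. -/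
def act (M : Mod C H) : H ⊗ M.X ⟶ M.X := M.mod.smul

theorem one_act (M : Mod C H) : η[H] ▷ M.X ≫ act M = (λ_ M.X).hom := M.mod.one_smul

theorem mul_act (M : Mod C H) :
    μ[H] ▷ M.X ≫ act M = (α_ H H M.X).hom ≫ H ◁ act M ≫ act M := M.mod.mul_smul

theorem act_hom {M N : Mod C H} (f : M ⟶ N) : act M ≫ f.hom = H ◁ f.hom ≫ act N :=
  f.isModHom.smul_hom

/-- An `H`-linear morphism from its underlying morphism. -/
@[reducible]
def mkHom {M N : Mod C H} (f : M.X ⟶ N.X) (h : act M ≫ f = H ◁ f ≫ act N) : M ⟶ N :=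
  Mod.Hom.mk' f h

/-- An `H`-linear isomorphism from its underlying isomorphism. -/
@[reducible]
def mkIso {M N : Mod C H} (f : M.X ≅ N.X) (h : act M ≫ f.hom = H ◁ f.hom ≫ act N) : M ≅ N where
  hom := mkHom f.hom h
  inv := mkHom f.inv (by
    rw [Iso.comp_inv_eq, Category.assoc, h, whiskerLeft_inv_hom_assoc])
  hom_inv_id := by ext; exact f.hom_inv_id
  inv_hom_id := by ext; exact f.inv_hom_id

/-- The diagonal action of `H` on a tensor product: comultiply, let the second copy of `H` pass
`M` by the braiding, and act on both factors. -/
def diagAct {M N : C} (a : H ⊗ M ⟶ M) (b : H ⊗ N ⟶ N) : H ⊗ (M ⊗ N) ⟶ M ⊗ N :=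
  Δ[H] ▷ (M ⊗ N) ≫ tensorμ H H M N ≫ (a ⊗ₘ b)

/-- The tensor product of two left `H`-modules. -/
def diagMod (M N : Mod C H) : Mod C H where
  X := M.X ⊗ N.X
  mod :=
    { smul := diagAct (act M) (act N)
      one_smul := by
        change η[H] ▷ (M.X ⊗ N.X) ≫ diagAct (act M) (act N) = (λ_ (M.X ⊗ N.X)).hom
        rw [diagAct, ← comp_whiskerRight_assoc, BimonObj.one_comul]
        change ((λ_ (𝟙_ C)).inv ≫ (η[H] ⊗ₘ η[H])) ▷ (M.X ⊗ N.X) ≫ _ = _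
        rw [comp_whiskerRight, Category.assoc, tensorμ_natural_left_assoc,
          tensorHom_comp_tensorHom, one_act, one_act]
        exact (tensor_left_unitality M.X N.X).symm
      mul_smul := by
        change μ[H] ▷ (M.X ⊗ N.X) ≫ diagAct (act M) (act N) =
          (α_ H H (M.X ⊗ N.X)).hom ≫ H ◁ diagAct (act M) (act N) ≫ diagAct (act M) (act N)
        have h := tensor_associativity H H H H M.X N.X
        rw [diagAct, ← comp_whiskerRight_assoc, BimonObj.mul_comul]
        simp only [comp_whiskerRight, Category.assoc, tensorμ_natural_left_assoc,
          tensorHom_comp_tensorHom, mul_act, whiskerLeft_comp]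
        simp only [← tensorHom_comp_tensorHom]
        rw [reassoc_of% h, whisker_exchange_assoc, whisker_exchange_assoc,
          tensorμ_natural_right_assoc, MonoidalCategory.tensorHom_def' Δ[H] Δ[H],
          comp_whiskerRight, Category.assoc, associator_naturality_left_assoc,
          associator_naturality_middle_assoc, whisker_exchange_assoc] }

/-- An object of `C` with the trivial `H`-action, through the counit. -/
def trivMod (X : C) : Mod C H where
  X := X
  mod :=
    { smul := ε[H] ▷ X ≫ (λ_ X).hom
      one_smul := by
        change η[H] ▷ X ≫ ε[H] ▷ X ≫ (λ_ X).hom = (λ_ X).hom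
        rw [← comp_whiskerRight_assoc, BimonObj.one_counit]
        simp
      mul_smul := by
        change μ[H] ▷ X ≫ ε[H] ▷ X ≫ (λ_ X).hom =
          (α_ H H X).hom ≫ H ◁ (ε[H] ▷ X ≫ (λ_ X).hom) ≫ ε[H] ▷ X ≫ (λ_ X).hom
        rw [← comp_whiskerRight_assoc, BimonObj.mul_counit, whisker_exchange_assoc]
        change ((ε[H] ⊗ₘ ε[H]) ≫ (λ_ (𝟙_ C)).hom) ▷ X ≫ _ = _
        simp [MonoidalCategory.tensorHom_def] }

theorem diagAct_natural {M M' N N' : Mod C H} (f : M ⟶ M') (g : N ⟶ N') :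
    diagAct (act M) (act N) ≫ (f.hom ⊗ₘ g.hom) =
      H ◁ (f.hom ⊗ₘ g.hom) ≫ diagAct (act M') (act N') := by
  simp only [diagAct, Category.assoc, tensorHom_comp_tensorHom, act_hom]
  rw [whisker_exchange_assoc, tensorμ_natural_right_assoc, tensorHom_comp_tensorHom]

theorem diagAct_assoc {L M N : C} (a : H ⊗ L ⟶ L) (b : H ⊗ M ⟶ M) (c : H ⊗ N ⟶ N) :
    diagAct (diagAct a b) c ≫ (α_ L M N).hom =
      H ◁ (α_ L M N).hom ≫ diagAct a (diagAct b c) := by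
  have h := associator_monoidal H H H L M N
  have e₁ : (diagAct a b ⊗ₘ c) =
      (Δ[H] ▷ (L ⊗ M) ⊗ₘ 𝟙 H ▷ N) ≫ tensorμ H H L M ▷ (H ⊗ N) ≫ ((a ⊗ₘ b) ⊗ₘ c) := by
    simp only [diagAct, ← tensorHom_id, tensorHom_comp_tensorHom, Category.id_comp,
      id_tensorHom_id]
  have e₂ : (a ⊗ₘ diagAct b c) =
      (𝟙 H ▷ L ⊗ₘ Δ[H] ▷ (M ⊗ N)) ≫ (H ⊗ L) ◁ tensorμ H H M N ≫ (a ⊗ₘ (b ⊗ₘ c)) := by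
    simp only [diagAct, ← tensorHom_id, ← id_tensorHom, tensorHom_comp_tensorHom,
      Category.id_comp, id_tensorHom_id]
  change (Δ[H] ▷ ((L ⊗ M) ⊗ N) ≫ tensorμ H H (L ⊗ M) N ≫ (diagAct a b ⊗ₘ c)) ≫ _ =
    _ ≫ Δ[H] ▷ (L ⊗ M ⊗ N) ≫ tensorμ H H L (M ⊗ N) ≫ (a ⊗ₘ diagAct b c)
  rw [e₁, e₂, ← tensorμ_natural_left_assoc, ← tensorμ_natural_left_assoc]
  simp only [Category.assoc, associator_naturality]
  rw [reassoc_of% h, MonoidalCategory.tensorHom_def (α_ H H H).hom, Category.assoc,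
    whisker_exchange_assoc, whisker_exchange_assoc]
  have e₃ : Δ[H] ≫ (Δ[H] ⊗ₘ 𝟙 H) ≫ (α_ H H H).hom = Δ[H] ≫ (𝟙 H ⊗ₘ Δ[H]) := by simp
  simp only [← comp_whiskerRight_assoc, e₃]

theorem diagAct_leftUnitor {M : C} (a : H ⊗ M ⟶ M) :
    diagAct (ε[H] ▷ 𝟙_ C ≫ (λ_ (𝟙_ C)).hom) a ≫ (λ_ M).hom = H ◁ (λ_ M).hom ≫ a := by
  have h := leftUnitor_monoidal H M
  have e : ((ε[H] ▷ 𝟙_ C ≫ (λ_ (𝟙_ C)).hom) ⊗ₘ a) =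
      (ε[H] ▷ 𝟙_ C ⊗ₘ 𝟙 H ▷ M) ≫ (λ_ (𝟙_ C)).hom ▷ (H ⊗ M) ≫ 𝟙_ C ◁ a := by
    simp only [← tensorHom_id, ← id_tensorHom, tensorHom_comp_tensorHom, Category.id_comp,
      Category.comp_id, id_tensorHom_id]
  rw [diagAct, e, ← tensorμ_natural_left_assoc]
  simp only [Category.assoc, leftUnitor_naturality]
  rw [← reassoc_of% h, MonoidalCategory.tensorHom_def (λ_ H).hom, Category.assoc, ← comp_whiskerRight_assoc,
    ← comp_whiskerRight_assoc]
  simp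

theorem diagAct_rightUnitor {M : C} (a : H ⊗ M ⟶ M) :
    diagAct a (ε[H] ▷ 𝟙_ C ≫ (λ_ (𝟙_ C)).hom) ≫ (ρ_ M).hom = H ◁ (ρ_ M).hom ≫ a := by
  have h := rightUnitor_monoidal H M
  have e : (a ⊗ₘ (ε[H] ▷ 𝟙_ C ≫ (λ_ (𝟙_ C)).hom)) =
      (𝟙 H ▷ M ⊗ₘ ε[H] ▷ 𝟙_ C) ≫ (H ⊗ M) ◁ (λ_ (𝟙_ C)).hom ≫ a ▷ 𝟙_ C := by
    simp only [← tensorHom_id, ← id_tensorHom, tensorHom_comp_tensorHom, Category.id_comp,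
      Category.comp_id, id_tensorHom_id]
  rw [diagAct, e, ← tensorμ_natural_left_assoc]
  simp only [Category.assoc, rightUnitor_naturality]
  rw [← reassoc_of% h, MonoidalCategory.tensorHom_def (ρ_ H).hom, Category.assoc, ← comp_whiskerRight_assoc,
    ← comp_whiskerRight_assoc]
  simp

instance : MonoidalCategoryStruct (Mod C H) where
  tensorObj := diagMod
  tensorUnit := trivMod (𝟙_ C)
  whiskerLeft M _ _ f := mkHom (M.X ◁ f.hom) (by
    have := diagAct_natural (𝟙 M) f
    simp only [Mod.id_hom', id_tensorHom] at this
    exact this)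
  whiskerRight f N := mkHom (f.hom ▷ N.X) (by
    have := diagAct_natural f (𝟙 N)
    simp only [Mod.id_hom', tensorHom_id] at this
    exact this)
  tensorHom f g := mkHom (f.hom ⊗ₘ g.hom) (diagAct_natural f g)
  associator L M N := mkIso (α_ L.X M.X N.X) (diagAct_assoc (act L) (act M) (act N))
  leftUnitor M := mkIso (λ_ M.X) (diagAct_leftUnitor (act M))
  rightUnitor M := mkIso (ρ_ M.X) (diagAct_rightUnitor (act M))

instance : MonoidalCategory (Mod C H) where
  tensorHom_def f g := Mod.hom_ext _ _ (tensorHom_def f.hom g.hom)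
  id_tensorHom_id M N := Mod.hom_ext _ _ (id_tensorHom_id M.X N.X)
  tensorHom_comp_tensorHom f₁ f₂ g₁ g₂ :=
    Mod.hom_ext _ _ (tensorHom_comp_tensorHom f₁.hom f₂.hom g₁.hom g₂.hom)
  whiskerLeft_id M N := Mod.hom_ext _ _ (whiskerLeft_id M.X N.X)
  id_whiskerRight M N := Mod.hom_ext _ _ (id_whiskerRight M.X N.X)
  associator_naturality f g h := Mod.hom_ext _ _ (associator_naturality f.hom g.hom h.hom)
  leftUnitor_naturality f := Mod.hom_ext _ _ (leftUnitor_naturality f.hom)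
  rightUnitor_naturality f := Mod.hom_ext _ _ (rightUnitor_naturality f.hom)
  pentagon K L M N := Mod.hom_ext _ _ (pentagon K.X L.X M.X N.X)
  triangle M N := Mod.hom_ext _ _ (triangle M.X N.X)

variable (H) in
/-- The braiding of `C` is `H`-linear: for all left `H`-modules `M` and `N` the braiding
`M ⊗ N ⟶ N ⊗ M` commutes with the diagonal `H`-actions. -/
class HLinearBraiding : Prop where
  linear (M N : Mod C H) :
    diagAct (act M) (act N) ≫ (β_ M.X N.X).hom = H ◁ (β_ M.X N.X).hom ≫ diagAct (act N) (act M)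

instance [HLinearBraiding H] : BraidedCategory (Mod C H) where
  braiding M N := mkIso (β_ M.X N.X) (HLinearBraiding.linear M N)
  braiding_naturality_right M _ _ f :=
    Mod.hom_ext _ _ (BraidedCategory.braiding_naturality_right M.X f.hom)
  braiding_naturality_left f N :=
    Mod.hom_ext _ _ (BraidedCategory.braiding_naturality_left f.hom N.X)
  hexagon_forward L M N := Mod.hom_ext _ _ (BraidedCategory.hexagon_forward L.X M.X N.X)
  hexagon_reverse L M N := Mod.hom_ext _ _ (BraidedCategory.hexagon_reverse L.X M.X N.X)

end Modules

/-! ### Consequences of the `H`-linearity of the braiding -/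

section Linear

variable {H : C} [BimonObj H]

theorem diagAct_triv_right {M : C} (a : H ⊗ M ⟶ M) (X : C) :
    diagAct a (ε[H] ▷ X ≫ (λ_ X).hom) = (α_ H M X).inv ≫ a ▷ X := by
  have e : (a ⊗ₘ (ε[H] ▷ X ≫ (λ_ X).hom)) =
      (𝟙 H ▷ M ⊗ₘ ε[H] ▷ X) ≫ (a ⊗ₘ (λ_ X).hom) := by
    simp only [← tensorHom_id, tensorHom_comp_tensorHom, Category.id_comp,
      id_tensorHom_id]
  rw [diagAct, e, ← tensorμ_natural_left_assoc, ← comp_whiskerRight_assoc, id_tensorHom,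
    ComonObj.comul_counit]
  simp only [tensorμ, MonoidalCategory.tensorHom_def']
  simp [← whiskerLeft_comp_assoc, -whiskerLeft_comp]

theorem diagAct_triv_left {N : C} (b : H ⊗ N ⟶ N) (X : C) :
    diagAct (ε[H] ▷ X ≫ (λ_ X).hom) b =
      (α_ H X N).inv ≫ (β_ H X).hom ▷ N ≫ (α_ X H N).hom ≫ X ◁ b := by
  have e : ((ε[H] ▷ X ≫ (λ_ X).hom) ⊗ₘ b) =
      (ε[H] ▷ X ⊗ₘ 𝟙 H ▷ N) ≫ ((λ_ X).hom ⊗ₘ b) := by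
    simp only [← tensorHom_id, tensorHom_comp_tensorHom, Category.id_comp,
      id_tensorHom_id]
  rw [diagAct, e, ← tensorμ_natural_left_assoc, ← comp_whiskerRight_assoc, tensorHom_id,
    ComonObj.counit_comul]
  simp [tensorμ, MonoidalCategory.tensorHom_def]

variable [HLinearBraiding H]

/-- The braidings with `H` are inverse to each other. -/
theorem braiding_symm (X : C) : (β_ H X).hom ≫ (β_ X H).hom = 𝟙 (H ⊗ X) := by
  have h := HLinearBraiding.linear (trivMod (H := H) X) (Mod.regular H)
  change diagAct (ε[H] ▷ X ≫ (λ_ X).hom) μ[H] ≫ (β_ X H).hom =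
    H ◁ (β_ X H).hom ≫ diagAct μ[H] (ε[H] ▷ X ≫ (λ_ X).hom) at h
  rw [diagAct_triv_left, diagAct_triv_right] at h
  have hl : H ◁ ((ρ_ X).inv ≫ X ◁ η[H]) ≫
      (α_ H X H).inv ≫ (β_ H X).hom ▷ H ≫ (α_ X H H).hom ≫ X ◁ μ[H] = (β_ H X).hom := by
    rw [whiskerLeft_comp, Category.assoc, associator_inv_naturality_right_assoc,
      whisker_exchange_assoc, associator_naturality_right_assoc, ← whiskerLeft_comp,
      MonObj.mul_one]
    simp
  have hr : H ◁ ((ρ_ X).inv ≫ X ◁ η[H]) ≫ H ◁ (β_ X H).hom ≫ (α_ H H X).inv ≫ μ[H] ▷ X =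
      𝟙 (H ⊗ X) := by
    rw [← whiskerLeft_comp_assoc, Category.assoc, BraidedCategory.braiding_naturality_right,
      rightUnitor_inv_braiding_assoc, whiskerLeft_comp, Category.assoc,
      associator_inv_naturality_middle_assoc, ← comp_whiskerRight, MonObj.mul_one]
    simp
  have h' := congrArg (fun t => H ◁ ((ρ_ X).inv ≫ X ◁ η[H]) ≫ t) h
  beta_reduce at h'
  rw [hr, ← Category.assoc, hl] at h'
  exact h'

theorem cocomm : Δ[H] ≫ (β_ H H).hom = Δ[H] := by
  have h := HLinearBraiding.linear (Mod.regular H) (Mod.regular H)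
  change (Δ[H] ▷ (H ⊗ H) ≫ μ[H ⊗ H]) ≫ (β_ H H).hom =
    H ◁ (β_ H H).hom ≫ Δ[H] ▷ (H ⊗ H) ≫ μ[H ⊗ H] at h
  have e : H ◁ η[H ⊗ H] ≫ Δ[H] ▷ (H ⊗ H) ≫ μ[H ⊗ H] = (ρ_ H).hom ≫ Δ[H] := by
    rw [whisker_exchange_assoc, MonObj.mul_one, rightUnitor_naturality]
  have h' := congrArg (fun t => H ◁ η[H ⊗ H] ≫ t) h
  simp only [← Category.assoc] at h' e
  rw [e, ← whiskerLeft_comp, MonObj.one_braiding, e] at h'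
  simpa using h'

end Linear

/-! ### Flat objects -/

/-- An object is flat if tensoring with it preserves equalizers. -/
class IsFlat (X : C) : Prop where
  preserves : PreservesLimitsOfShape WalkingParallelPair (tensorLeft X)

/-- An object is faithfully flat if tensoring with it preserves and reflects equalizers. -/
class IsFaithfullyFlat (X : C) : Prop extends IsFlat X where
  reflects : ReflectsLimitsOfShape WalkingParallelPair (tensorLeft X)

theorem IsFlat.preserves_right (X : C) [IsFlat X] :
    PreservesLimitsOfShape WalkingParallelPair (tensorRight X) :=
  haveI := IsFlat.preserves (X := X)
  preservesLimitsOfShape_of_natIso (BraidedCategory.tensorLeftIsoTensorRight X)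

section Flat

variable [HasEqualizers C] {H : C} [IsFlat H]

/-- Tensoring with the flat object `H` preserves equalizers. -/
noncomputable def equalizerTensor {M N : C} (f g : M ⟶ N) :
    IsLimit (Fork.ofι (f := f ▷ H) (g := g ▷ H) (equalizer.ι f g ▷ H)
      (by rw [← comp_whiskerRight, equalizer.condition, comp_whiskerRight])) :=
  haveI := IsFlat.preserves_right H
  isLimitForkMapOfIsLimit (tensorRight H) (equalizer.condition f g) (equalizerIsEqualizer f g)

theorem mono_tensor {M N : C} (f g : M ⟶ N) : Mono (equalizer.ι f g ▷ H) :=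
  mono_of_isLimit_fork (equalizerTensor f g)

theorem mono_tensor_tensor {M N : C} (f g : M ⟶ N) : Mono (equalizer.ι f g ▷ H ▷ H) :=
  haveI := IsFlat.preserves_right H
  mono_of_isLimit_fork (isLimitForkMapOfIsLimit (tensorRight H) _ (equalizerTensor (H := H) f g))

end Flat

/-! ### Comodule algebras and Galois objects -/

section ComodAlg

/-- A right `H`-comodule algebra: an algebra with a right `H`-coaction that is an algebra
morphism. -/
structure ComodAlg (H : C) [BimonObj H] where
  /-- The underlying object. -/
  X : C
  [mon : MonObj X]
  /-- The coaction. -/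
  coact : X ⟶ X ⊗ H
  coact_counit : coact ≫ X ◁ ε[H] = (ρ_ X).inv
  coact_coassoc : coact ≫ X ◁ Δ[H] = coact ≫ coact ▷ H ≫ (α_ X H H).hom
  [isMonHom : IsMonHom coact]

attribute [instance] ComodAlg.mon ComodAlg.isMonHom

variable {H : C} [BimonObj H]

/-- A morphism of right `H`-comodule algebras. -/
@[ext]
structure ComodAlg.Hom (S T : ComodAlg H) where
  /-- The underlying morphism. -/
  hom : S.X ⟶ T.X
  [isMonHom : IsMonHom hom]
  colinear : S.coact ≫ hom ▷ H = hom ≫ T.coact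

attribute [instance] ComodAlg.Hom.isMonHom

instance : Category (ComodAlg H) where
  Hom := ComodAlg.Hom
  id S := { hom := 𝟙 S.X, colinear := by simp }
  comp f g :=
    { hom := f.hom ≫ g.hom
      colinear := by
        rw [comp_whiskerRight, ← Category.assoc, f.colinear, Category.assoc, g.colinear,
          Category.assoc] }
  id_comp f := by apply ComodAlg.Hom.ext; exact Category.id_comp f.hom
  comp_id f := by apply ComodAlg.Hom.ext; exact Category.comp_id f.hom
  assoc f g h := by apply ComodAlg.Hom.ext; exact Category.assoc f.hom g.hom h.hom

/-- The canonical morphism `T ⊗ T ⟶ T ⊗ H`, `x ⊗ y ↦ x y₀ ⊗ y₁`. -/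
def ComodAlg.can (T : ComodAlg H) : T.X ⊗ T.X ⟶ T.X ⊗ H :=
  T.X ◁ T.coact ≫ (α_ T.X T.X H).inv ≫ μ[T.X] ▷ H

/-- An `H`-Galois object is a faithfully flat right `H`-comodule algebra whose canonical morphism
is an isomorphism. -/
structure IsGaloisObj (T : ComodAlg H) : Prop where
  faithfullyFlat : IsFaithfullyFlat T.X
  isIso_can : IsIso T.can

section Sub

/-- The comodule algebra structure on a subobject `j : E ⟶ M` of a comodule algebra `M` to which
the unit, the multiplication and the coaction restrict. -/
@[reducible]
def ComodAlg.ofMono (M : ComodAlg H) {E : C} (j : E ⟶ M.X) [Mono j] [Mono (j ▷ H)]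
    [Mono (j ▷ H ▷ H)] (one : 𝟙_ C ⟶ E) (mul : E ⊗ E ⟶ E) (ρ : E ⟶ E ⊗ H)
    (h₁ : one ≫ j = η[M.X]) (h₂ : mul ≫ j = (j ⊗ₘ j) ≫ μ[M.X])
    (h₃ : ρ ≫ j ▷ H = j ≫ M.coact) : ComodAlg H :=
  letI mon : MonObj E :=
    { one := one
      mul := mul
      one_mul := by
        rw [← cancel_mono j, Category.assoc, h₂, MonoidalCategory.tensorHom_def',
          Category.assoc, whisker_exchange_assoc, ← comp_whiskerRight_assoc, h₁,
          ← whisker_exchange_assoc, MonObj.one_mul, leftUnitor_naturality]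
      mul_one := by
        rw [← cancel_mono j, Category.assoc, h₂, MonoidalCategory.tensorHom_def,
          Category.assoc, ← whisker_exchange_assoc, ← whiskerLeft_comp_assoc, h₁,
          whisker_exchange_assoc, MonObj.mul_one, rightUnitor_naturality]
      mul_assoc := by
        rw [← cancel_mono j]
        have e₁ : mul ▷ E ≫ (j ⊗ₘ j) = ((j ⊗ₘ j) ⊗ₘ j) ≫ μ[M.X] ▷ M.X := by
          simp only [← tensorHom_id, tensorHom_comp_tensorHom, h₂, Category.id_comp,
            Category.comp_id]
        have e₂ : E ◁ mul ≫ (j ⊗ₘ j) = (j ⊗ₘ (j ⊗ₘ j)) ≫ M.X ◁ μ[M.X] := by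
          simp only [← id_tensorHom, tensorHom_comp_tensorHom, h₂, Category.id_comp,
            Category.comp_id]
        simp only [Category.assoc, h₂]
        rw [reassoc_of% e₁, reassoc_of% e₂, MonObj.mul_assoc, associator_naturality_assoc] }
  haveI hj : IsMonHom j := ⟨h₁, h₂⟩
  { X := E
    coact := ρ
    coact_counit := by
      rw [← cancel_mono (ρ_ E).hom, ← cancel_mono j]
      have h := M.coact_counit
      rw [← cancel_mono (ρ_ M.X).hom, Iso.inv_hom_id] at h
      simp only [Category.assoc, Iso.inv_hom_id, Category.id_comp] at h ⊢
      rw [← rightUnitor_naturality, whisker_exchange_assoc, reassoc_of% h₃, h, Category.comp_id]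
    coact_coassoc := by
      rw [← cancel_mono (α_ E H H).inv, ← cancel_mono (j ▷ H ▷ H)]
      have h := M.coact_coassoc
      rw [← cancel_mono (α_ M.X H H).inv] at h
      simp only [Category.assoc, Iso.hom_inv_id, Category.comp_id] at h ⊢
      rw [← associator_inv_naturality_left, whisker_exchange_assoc, reassoc_of% h₃, h,
        ← comp_whiskerRight, h₃, comp_whiskerRight, reassoc_of% h₃]
    isMonHom :=
      { one_hom := by
          rw [← cancel_mono (j ▷ H), Category.assoc, h₃, IsMonHom.one_hom,
            IsMonHom.one_hom]
        mul_hom := by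
          rw [← cancel_mono (j ▷ H), Category.assoc, Category.assoc, h₃, IsMonHom.mul_hom (j ▷ H),
            ← Category.assoc, IsMonHom.mul_hom, Category.assoc, IsMonHom.mul_hom,
            tensorHom_comp_tensorHom_assoc, tensorHom_comp_tensorHom_assoc, h₃] } }

variable [HasEqualizers C] [IsFlat H]

/-- The equalizer of two morphisms out of a comodule algebra `M`, as a comodule subalgebra of `M`,
provided that it contains the unit and is closed under the multiplication and the coaction. -/
noncomputable def subComodAlg (M : ComodAlg H) {N : C} (f g : M.X ⟶ N)
    (h₁ : η[M.X] ≫ f = η[M.X] ≫ g)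
    (h₂ : (equalizer.ι f g ⊗ₘ equalizer.ι f g) ≫ μ[M.X] ≫ f =
      (equalizer.ι f g ⊗ₘ equalizer.ι f g) ≫ μ[M.X] ≫ g)
    (h₃ : equalizer.ι f g ≫ M.coact ≫ f ▷ H = equalizer.ι f g ≫ M.coact ≫ g ▷ H) :
    ComodAlg H :=
  haveI := mono_tensor (H := H) f g
  haveI := mono_tensor_tensor (H := H) f g
  M.ofMono (equalizer.ι f g) (equalizer.lift η[M.X] h₁)
    (equalizer.lift ((equalizer.ι f g ⊗ₘ equalizer.ι f g) ≫ μ[M.X]) (by simpa using h₂))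
    (Fork.IsLimit.lift (equalizerTensor f g) (equalizer.ι f g ≫ M.coact) (by simpa using h₃))
    (equalizer.lift_ι _ _) (equalizer.lift_ι _ _) (Fork.IsLimit.lift_ι' _ _ _)

end Sub

end ComodAlg

/-! ### The smash product -/

section Smash

variable {H : C} [BimonObj H]

/-- The underlying algebra in `C` of an `H`-module algebra, that is, of an algebra in the monoidal
category of left `H`-modules. -/
instance underlyingMon (A : Mod C H) [MonObj A] : MonObj A.X where
  one := η[A].hom
  mul := μ[A].hom
  one_mul := congrArg Mod.Hom.hom (MonObj.one_mul A)
  mul_one := congrArg Mod.Hom.hom (MonObj.mul_one A)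
  mul_assoc := congrArg Mod.Hom.hom (MonObj.mul_assoc A)

variable (A : Mod C H) [MonObj A]

/-- The diagonal action of `H` on `A ⊗ H`, `h ⊗ (b ⊗ k) ↦ h₁ b ⊗ h₂ k`. -/
def smashAct : H ⊗ (A.X ⊗ H) ⟶ A.X ⊗ H := diagAct (act A) μ[H]

/-- Left multiplication of `A` on `A ⊗ H`. -/
def smashLeft : A.X ⊗ (A.X ⊗ H) ⟶ A.X ⊗ H := (α_ A.X A.X H).inv ≫ μ[A.X] ▷ H

/-- The multiplication of the smash product, `(a # h)(b # k) = a (h₁ b) # h₂ k`. -/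
def smashMul : (A.X ⊗ H) ⊗ (A.X ⊗ H) ⟶ A.X ⊗ H :=
  (α_ A.X H (A.X ⊗ H)).hom ≫ A.X ◁ smashAct A ≫ smashLeft A

/-- The unit of the smash product, `1 # 1`. -/
def smashOne : 𝟙_ C ⟶ A.X ⊗ H := (λ_ (𝟙_ C)).inv ≫ (η[A.X] ⊗ₘ η[H])

theorem smashAct_left :
    H ◁ smashLeft A ≫ smashAct A = diagAct (act A) (smashAct A) ≫ smashLeft A :=
  (act_hom ((α_ A A (Mod.regular H)).inv ≫ μ[A] ▷ Mod.regular H)).symm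

theorem smashAct_unit :
    H ◁ ((λ_ H).inv ≫ η[A.X] ▷ H) ≫ smashAct A = μ[H] ≫ (λ_ H).inv ≫ η[A.X] ▷ H :=
  (act_hom ((λ_ (Mod.regular H)).inv ≫ η[A] ▷ Mod.regular H)).symm

theorem smashAct_one : η[H] ▷ (A.X ⊗ H) ≫ smashAct A = (λ_ (A.X ⊗ H)).hom :=
  one_act (A ⊗ Mod.regular H)

theorem smashAct_mul : μ[H] ▷ (A.X ⊗ H) ≫ smashAct A =
    (α_ H H (A.X ⊗ H)).hom ≫ H ◁ smashAct A ≫ smashAct A :=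
  mul_act (A ⊗ Mod.regular H)

theorem smashLeft_assoc : μ[A.X] ▷ (A.X ⊗ H) ≫ smashLeft A =
    (α_ A.X A.X (A.X ⊗ H)).hom ≫ A.X ◁ smashLeft A ≫ smashLeft A := by
  have h : (μ[A.X] ▷ A.X ≫ μ[A.X]) ▷ H =
      ((α_ A.X A.X A.X).hom ≫ A.X ◁ μ[A.X] ≫ μ[A.X]) ▷ H := by rw [MonObj.mul_assoc]
  simp only [comp_whiskerRight] at h
  rw [smashLeft, associator_inv_naturality_left_assoc, h]
  monoidal

theorem smashLeft_mul : smashLeft A ▷ (A.X ⊗ H) ≫ smashMul A =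
    (α_ A.X (A.X ⊗ H) (A.X ⊗ H)).hom ≫ A.X ◁ smashMul A ≫ smashLeft A := by
  rw [smashMul]
  nth_rw 1 [smashLeft]
  rw [comp_whiskerRight, Category.assoc, associator_naturality_left_assoc,
    ← whisker_exchange_assoc, smashLeft_assoc]
  generalize smashAct A = d
  generalize smashLeft A = l
  monoidal

theorem smashAct_smashMul : smashAct A ▷ (A.X ⊗ H) ≫ smashMul A =
    (α_ H (A.X ⊗ H) (A.X ⊗ H)).hom ≫ H ◁ smashMul A ≫ smashAct A := by
  have e₁ : H ◁ (A.X ◁ smashAct A) ≫ diagAct (act A) (smashAct A) =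
      Δ[H] ▷ (A.X ⊗ H ⊗ A.X ⊗ H) ≫ tensorμ H H A.X (H ⊗ A.X ⊗ H) ≫
        (H ⊗ A.X) ◁ ((α_ H H (A.X ⊗ H)).inv ≫ μ[H] ▷ (A.X ⊗ H) ≫ smashAct A) ≫
          act A ▷ (A.X ⊗ H) := by
    rw [smashAct_mul, Iso.inv_hom_id_assoc, diagAct, whisker_exchange_assoc, ← id_tensorHom A.X,
      tensorμ_natural_right_assoc]
    simp only [← tensorHom_id, ← id_tensorHom, tensorHom_comp_tensorHom, Category.id_comp,
      Category.comp_id, id_tensorHom_id]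
  have e₂ : smashAct A = Δ[H] ▷ (A.X ⊗ H) ≫ tensorμ H H A.X H ≫ (H ⊗ A.X) ◁ μ[H] ≫
      act A ▷ H := by
    simp only [smashAct, diagAct, ← tensorHom_id, ← id_tensorHom, tensorHom_comp_tensorHom,
      Category.id_comp, Category.comp_id]
  have e₃ : (tensorμ H H A.X H) ▷ (A.X ⊗ H) ≫ (α_ (H ⊗ A.X) (H ⊗ H) (A.X ⊗ H)).hom =
      (α_ (H ⊗ H) (A.X ⊗ H) (A.X ⊗ H)).hom ≫ (H ⊗ H) ◁ (α_ A.X H (A.X ⊗ H)).hom ≫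
        tensorμ H H A.X (H ⊗ A.X ⊗ H) ≫ (H ⊗ A.X) ◁ (α_ H H (A.X ⊗ H)).inv := by
    simp only [tensorμ]
    monoidal
  have e₄ : smashAct A ▷ (A.X ⊗ H) ≫ (α_ A.X H (A.X ⊗ H)).hom ≫ A.X ◁ smashAct A =
      (α_ H (A.X ⊗ H) (A.X ⊗ H)).hom ≫ H ◁ (α_ A.X H (A.X ⊗ H)).hom ≫
        H ◁ (A.X ◁ smashAct A) ≫ diagAct (act A) (smashAct A) := by
    rw [e₁]
    nth_rw 1 [e₂]
    simp only [comp_whiskerRight, Category.assoc, whiskerLeft_comp]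
    rw [whisker_exchange_assoc, ← associator_naturality_left_assoc, ← reassoc_of% e₃,
      associator_naturality_left_assoc, ← whisker_exchange, associator_naturality_middle_assoc]
  rw [smashMul]
  simp only [whiskerLeft_comp, Category.assoc]
  rw [smashAct_left, reassoc_of% e₄]

/-- The smash product algebra `A # H`, with underlying object `A ⊗ H`. -/
@[reducible]
def smashMon : MonObj (A.X ⊗ H) where
  one := smashOne A
  mul := smashMul A
  one_mul := by
    have e : smashOne A = η[A.X] ≫ (ρ_ A.X).inv ≫ A.X ◁ η[H] := by
      simp [smashOne, MonoidalCategory.tensorHom_def, unitors_inv_equal]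
    rw [e, smashMul]
    simp only [comp_whiskerRight, Category.assoc]
    rw [associator_naturality_middle_assoc, ← whiskerLeft_comp_assoc, smashAct_one, smashLeft]
    have h : (η[A.X] ▷ A.X ≫ μ[A.X]) ▷ H = (λ_ A.X).hom ▷ H := by rw [MonObj.one_mul]
    rw [comp_whiskerRight] at h
    have h' : (ρ_ A.X).inv ▷ (A.X ⊗ H) ≫ (α_ A.X (𝟙_ C) (A.X ⊗ H)).hom ≫
      A.X ◁ (λ_ (A.X ⊗ H)).hom = 𝟙 _ := by monoidal
    rw [reassoc_of% h', associator_inv_naturality_left_assoc, h]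
    monoidal
  mul_one := by
    have e : smashOne A = η[H] ≫ (λ_ H).inv ≫ η[A.X] ▷ H := by
      simp [smashOne, MonoidalCategory.tensorHom_def']
    have h := congrArg (fun t => H ◁ η[H] ≫ t) (smashAct_unit A)
    simp only [MonObj.mul_one_assoc] at h
    rw [e, smashMul, associator_naturality_right_assoc, ← whiskerLeft_comp_assoc,
      whiskerLeft_comp H η[H], Category.assoc, h, smashLeft]
    have h' : (A.X ◁ η[A.X] ≫ μ[A.X]) ▷ H = (ρ_ A.X).hom ▷ H := by rw [MonObj.mul_one]
    rw [comp_whiskerRight] at h'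
    simp only [whiskerLeft_comp, Category.assoc]
    rw [associator_inv_naturality_middle_assoc, h']
    monoidal
  mul_assoc := by
    have e₁ : smashMul A ▷ (A.X ⊗ H) = (α_ A.X H (A.X ⊗ H)).hom ▷ (A.X ⊗ H) ≫
        (A.X ◁ smashAct A) ▷ (A.X ⊗ H) ≫ smashLeft A ▷ (A.X ⊗ H) := by
      rw [smashMul, comp_whiskerRight, comp_whiskerRight]
    have e₂ : (A.X ⊗ H) ◁ smashMul A ≫ smashMul A =
        (α_ A.X H _).hom ≫ A.X ◁ (H ◁ smashMul A) ≫ A.X ◁ smashAct A ≫ smashLeft A := by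
      rw [← associator_naturality_right_assoc, ← smashMul]
    have h := congrArg (fun t => A.X ◁ t ≫ smashLeft A) (smashAct_smashMul A)
    simp only [whiskerLeft_comp, Category.assoc] at h
    rw [e₁, e₂, Category.assoc, Category.assoc, smashLeft_mul, associator_naturality_middle_assoc,
      h, pentagon_assoc]

/-- The coaction `A ⊗ Δ` on the smash product. -/
def smashCoact : A.X ⊗ H ⟶ (A.X ⊗ H) ⊗ H := A.X ◁ Δ[H] ≫ (α_ A.X H H).inv

/-- The comultiplication as a morphism of left `H`-modules. -/
def comulHom : Mod.regular H ⟶ Mod.regular H ⊗ Mod.regular H :=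
  mkHom (M := Mod.regular H) (N := Mod.regular H ⊗ Mod.regular H) Δ[H] (by
    change μ[H] ≫ Δ[H] = H ◁ Δ[H] ≫ Δ[H] ▷ (H ⊗ H) ≫ tensorμ H H H H ≫ (μ[H] ⊗ₘ μ[H])
    rw [BimonObj.mul_comul, MonoidalCategory.tensorHom_def' Δ[H] Δ[H], Category.assoc])

theorem smashAct_coact :
    smashAct A ≫ smashCoact A = H ◁ smashCoact A ≫ diagAct (smashAct A) μ[H] :=
  act_hom (A ◁ comulHom ≫ (α_ A (Mod.regular H) (Mod.regular H)).inv)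

theorem smashLeft_coact : smashLeft A ≫ smashCoact A =
    A.X ◁ smashCoact A ≫ (α_ A.X (A.X ⊗ H) H).inv ≫ smashLeft A ▷ H := by
  rw [smashLeft, smashCoact, Category.assoc, ← whisker_exchange_assoc]
  monoidal

theorem smashMul_coact : smashMul A ≫ smashCoact A =
    (smashCoact A ⊗ₘ smashCoact A) ≫ tensorμ (A.X ⊗ H) H (A.X ⊗ H) H ≫
      (smashMul A ⊗ₘ μ[H]) := by
  have e₁ : (α_ A.X (H ⊗ H) ((A.X ⊗ H) ⊗ H)).hom ≫ A.X ◁ tensorμ H H (A.X ⊗ H) H ≫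
      (α_ A.X (H ⊗ A.X ⊗ H) (H ⊗ H)).inv =
      (α_ A.X H H).inv ▷ ((A.X ⊗ H) ⊗ H) ≫ tensorμ (A.X ⊗ H) H (A.X ⊗ H) H ≫
        (α_ A.X H (A.X ⊗ H)).hom ▷ (H ⊗ H) := by
    simp only [tensorμ]
    monoidal
  have e₂ : (smashMul A ⊗ₘ μ[H]) = (α_ A.X H (A.X ⊗ H)).hom ▷ (H ⊗ H) ≫
      (A.X ◁ smashAct A ⊗ₘ μ[H]) ≫ smashLeft A ▷ H := by
    simp only [smashMul, ← tensorHom_id, tensorHom_comp_tensorHom, Category.id_comp,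
      Category.comp_id]
  have e₃ : A.X ◁ (smashAct A ⊗ₘ μ[H]) ≫ (α_ A.X (A.X ⊗ H) H).inv =
      (α_ A.X (H ⊗ A.X ⊗ H) (H ⊗ H)).inv ≫ (A.X ◁ smashAct A ⊗ₘ μ[H]) := by
    rw [← id_tensorHom, associator_inv_naturality, id_tensorHom]
  have e₄ : smashMul A ≫ smashCoact A = (A.X ⊗ H) ◁ smashCoact A ≫
      (α_ A.X H ((A.X ⊗ H) ⊗ H)).hom ≫ A.X ◁ diagAct (smashAct A) μ[H] ≫
        (α_ A.X (A.X ⊗ H) H).inv ≫ smashLeft A ▷ H := by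
    rw [smashMul, Category.assoc, Category.assoc, smashLeft_coact, ← whiskerLeft_comp_assoc,
      smashAct_coact, whiskerLeft_comp, Category.assoc, associator_naturality_right_assoc]
  rw [e₄, e₂, MonoidalCategory.tensorHom_def' (smashCoact A), Category.assoc, diagAct]
  have e₅ : smashCoact A ▷ ((A.X ⊗ H) ⊗ H) =
      (A.X ◁ Δ[H]) ▷ ((A.X ⊗ H) ⊗ H) ≫ (α_ A.X H H).inv ▷ ((A.X ⊗ H) ⊗ H) := by
    rw [smashCoact, comp_whiskerRight]
  rw [e₅]
  simp only [whiskerLeft_comp, comp_whiskerRight, Category.assoc]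
  rw [reassoc_of% e₃, ← reassoc_of% e₁, associator_naturality_middle_assoc]

/-- The smash product `A # H` as a right `H`-comodule algebra, with coaction `A ⊗ Δ`. -/
def smash : ComodAlg H where
  X := A.X ⊗ H
  mon := smashMon A
  coact := smashCoact A
  coact_counit := by
    rw [smashCoact, Category.assoc, ← associator_inv_naturality_right, ← whiskerLeft_comp_assoc,
      ComonObj.comul_counit]
    monoidal
  coact_coassoc := by
    have h := congrArg (fun t => A.X ◁ t) (ComonObj.comul_assoc H)
    simp only [whiskerLeft_comp] at h
    rw [smashCoact, Category.assoc, ← associator_inv_naturality_right, reassoc_of% h,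
      comp_whiskerRight]
    monoidal
  isMonHom :=
    letI := smashMon A
    { one_hom := by
        change smashOne A ≫ smashCoact A = (λ_ (𝟙_ C)).inv ≫ (smashOne A ⊗ₘ η[H])
        have h : η[H] ≫ Δ[H] = (λ_ (𝟙_ C)).inv ≫ (η[H] ⊗ₘ η[H]) := BimonObj.one_comul H
        have e : (η[A.X] ⊗ₘ η[H]) ≫ A.X ◁ Δ[H] =
            𝟙_ C ◁ (λ_ (𝟙_ C)).inv ≫ (η[A.X] ⊗ₘ (η[H] ⊗ₘ η[H])) := by
          simp only [← id_tensorHom, tensorHom_comp_tensorHom, h, Category.id_comp,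
            Category.comp_id]
        have e' : (smashOne A ⊗ₘ η[H]) =
            (λ_ (𝟙_ C)).inv ▷ 𝟙_ C ≫ ((η[A.X] ⊗ₘ η[H]) ⊗ₘ η[H]) := by
          simp only [smashOne, ← tensorHom_id, tensorHom_comp_tensorHom, Category.id_comp]
        rw [e', smashOne, smashCoact, Category.assoc, reassoc_of% e, associator_inv_naturality]
        monoidal
      mul_hom := by
        exact smashMul_coact A }

/-- The embedding `a ↦ a # 1` of `A` into the smash product. -/
def smashIncl : A.X ⟶ (smash A).X := (ρ_ A.X).inv ≫ A.X ◁ η[H]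

theorem smashIncl_coact :
    smashIncl A ≫ (smash A).coact = (ρ_ A.X).inv ≫ (smashIncl A ⊗ₘ η[H]) := by
  change ((ρ_ A.X).inv ≫ A.X ◁ η[H]) ≫ A.X ◁ Δ[H] ≫ (α_ A.X H H).inv =
    (ρ_ A.X).inv ≫ (((ρ_ A.X).inv ≫ A.X ◁ η[H]) ⊗ₘ η[H])
  have h : η[H] ≫ Δ[H] = (λ_ (𝟙_ C)).inv ≫ (η[H] ⊗ₘ η[H]) := BimonObj.one_comul H
  rw [Category.assoc, ← whiskerLeft_comp_assoc, h]
  simp only [MonoidalCategory.tensorHom_def]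
  monoidal

end Smash

/-! ### Invariants -/

section Invariants

/-- An object `X` is finite if `X ⊗ -` has the right adjoint `P ⊗ -` for some object `P`,
that is, if `X` has a dual object `P`. -/
def IsFinite (X : C) : Prop := ∃ P : C, Nonempty (ExactPairing P X)

theorem IsFinite.tensor {X Y : C} (hX : IsFinite X) (hY : IsFinite Y) : IsFinite (X ⊗ Y) := by
  obtain ⟨P, ⟨p⟩⟩ := hX
  obtain ⟨Q, ⟨q⟩⟩ := hY
  exact ⟨Q ⊗ P, ⟨inferInstance⟩⟩

section Commutant

variable {M : C} [MonObj M] {A : C} (i : A ⟶ M)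

/-- Left multiplication by `A` through `i : A ⟶ M`. -/
def leftMul : A ⊗ M ⟶ M := i ▷ M ≫ μ[M]

/-- Right multiplication by `A` through `i : A ⟶ M`, preceded by the braiding. -/
def rightMul : A ⊗ M ⟶ M := (β_ A M).hom ≫ M ◁ i ≫ μ[M]

theorem one_leftMul : A ◁ η[M] ≫ leftMul i = A ◁ η[M] ≫ rightMul i := by
  have h₁ : A ◁ η[M] ≫ leftMul i = (ρ_ A).hom ≫ i := by
    rw [leftMul, whisker_exchange_assoc, MonObj.mul_one, rightUnitor_naturality]
  have h₂ : A ◁ η[M] ≫ rightMul i = (ρ_ A).hom ≫ i := by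
    rw [rightMul, BraidedCategory.braiding_naturality_right_assoc, ← whisker_exchange_assoc,
      MonObj.one_mul, leftUnitor_naturality, braiding_leftUnitor_assoc]
  rw [h₁, h₂]

theorem mul_leftMul : A ◁ μ[M] ≫ leftMul i = (α_ A M M).inv ≫ leftMul i ▷ M ≫ μ[M] := by
  rw [leftMul, whisker_exchange_assoc, comp_whiskerRight, Category.assoc, MonObj.mul_assoc,
    associator_naturality_left_assoc, Iso.inv_hom_id_assoc]

theorem mul_rightMul : A ◁ μ[M] ≫ rightMul i =
    (α_ A M M).inv ≫ (β_ A M).hom ▷ M ≫ (α_ M A M).hom ≫ M ◁ rightMul i ≫ μ[M] := by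
  have h := MonObj.mul_assoc M
  rw [rightMul, BraidedCategory.braiding_naturality_right_assoc, ← whisker_exchange_assoc,
    MonObj.mul_assoc, associator_naturality_right_assoc, BraidedCategory.braiding_tensor_right_hom]
  simp

theorem rightMul_mul : rightMul i ▷ M ≫ μ[M] =
    (β_ A M).hom ▷ M ≫ (α_ M A M).hom ≫ M ◁ leftMul i ≫ μ[M] := by
  simp [rightMul, leftMul]

theorem leftMul_comm {E : C} (j : E ⟶ M) (h : A ◁ j ≫ leftMul i = A ◁ j ≫ rightMul i) :
    A ◁ ((j ⊗ₘ j) ≫ μ[M]) ≫ leftMul i = A ◁ ((j ⊗ₘ j) ≫ μ[M]) ≫ rightMul i := by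
  rw [whiskerLeft_comp, Category.assoc, Category.assoc, mul_leftMul, mul_rightMul]
  have e₁ : A ◁ (j ⊗ₘ j) ≫ (α_ A M M).inv ≫ leftMul i ▷ M ≫ μ[M] =
      A ◁ (j ⊗ₘ j) ≫ (α_ A M M).inv ≫ rightMul i ▷ M ≫ μ[M] := by
    have e (t : A ⊗ M ⟶ M) : A ◁ (j ⊗ₘ j) ≫ (α_ A M M).inv ≫ t ▷ M ≫ μ[M] =
        (α_ A E E).inv ≫ (A ◁ j ≫ t) ▷ E ≫ M ◁ j ≫ μ[M] := by
      simp only [MonoidalCategory.tensorHom_def', whiskerLeft_comp, comp_whiskerRight,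
        Category.assoc]
      rw [associator_inv_naturality_middle_assoc, associator_inv_naturality_right_assoc,
        whisker_exchange_assoc, whisker_exchange_assoc]
    rw [e, e, h]
  have e₂ : A ◁ (j ⊗ₘ j) ≫ (α_ A M M).inv ≫ (β_ A M).hom ▷ M ≫ (α_ M A M).hom ≫
      M ◁ leftMul i ≫ μ[M] = A ◁ (j ⊗ₘ j) ≫ (α_ A M M).inv ≫ (β_ A M).hom ▷ M ≫
        (α_ M A M).hom ≫ M ◁ rightMul i ≫ μ[M] := by
    have e (t : A ⊗ M ⟶ M) : A ◁ (j ⊗ₘ j) ≫ (α_ A M M).inv ≫ (β_ A M).hom ▷ M ≫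
        (α_ M A M).hom ≫ M ◁ t ≫ μ[M] = (α_ A E E).inv ≫ (β_ A E).hom ▷ E ≫
          (α_ E A E).hom ≫ E ◁ (A ◁ j ≫ t) ≫ j ▷ M ≫ μ[M] := by
      have e' : A ◁ (j ⊗ₘ j) ≫ (α_ A M M).inv ≫ (β_ A M).hom ▷ M ≫ (α_ M A M).hom =
          (α_ A E E).inv ≫ (β_ A E).hom ▷ E ≫ (α_ E A E).hom ≫ E ◁ (A ◁ j) ≫
            j ▷ (A ⊗ M) := by
        simp only [MonoidalCategory.tensorHom_def, whiskerLeft_comp, Category.assoc]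
        rw [associator_inv_naturality_right_assoc, whisker_exchange_assoc,
          associator_naturality_right, associator_inv_naturality_middle_assoc,
          ← comp_whiskerRight_assoc, BraidedCategory.braiding_naturality_right, comp_whiskerRight,
          Category.assoc, associator_naturality_left_assoc, whisker_exchange]
      rw [reassoc_of% e', ← whisker_exchange_assoc, whiskerLeft_comp, Category.assoc]
    rw [e, e, h]
  rw [e₁, rightMul_mul, e₂]

end Commutant

theorem curry_cancel_aux {A P : C} [ExactPairing P A] {M W H X : C} (ev : A ⊗ W ⟶ M)
    (θ : P ⊗ M ⟶ W)
    (hθ : (λ_ W).inv ≫ (η_ P A) ▷ W ≫ (α_ P A W).hom ≫ P ◁ ev ≫ θ = 𝟙 W) (z : X ⟶ W ⊗ H) :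
    (λ_ X).inv ≫ (η_ P A) ▷ X ≫ (α_ P A X).hom ≫
      P ◁ (A ◁ z ≫ (α_ A W H).inv ≫ ev ▷ H) ≫ (α_ P M H).inv ≫ θ ▷ H = z := by
  have h' := congrArg (fun t => t ▷ H) hθ
  simp only [comp_whiskerRight, id_whiskerRight] at h'
  simp only [whiskerLeft_comp, Category.assoc]
  rw [← associator_naturality_right_assoc, ← whisker_exchange_assoc,
    ← leftUnitor_inv_naturality_assoc]
  conv_rhs => rw [← Category.comp_id z, ← h']
  monoidal

theorem curry_cancel [MonoidalClosed C] {A : C} (hA : IsFinite A) {M H X : C}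
    (x y : X ⟶ (ihom A).obj M ⊗ H)
    (h : A ◁ x ≫ (α_ A _ H).inv ≫ (ihom.ev A).app M ▷ H =
      A ◁ y ≫ (α_ A _ H).inv ≫ (ihom.ev A).app M ▷ H) : x = y := by
  obtain ⟨P, ⟨p⟩⟩ := hA
  have hθ : (λ_ _).inv ≫ (η_ P A) ▷ _ ≫ (α_ P A _).hom ≫ P ◁ (ihom.ev A).app M ≫
      MonoidalClosed.curry ((α_ A P M).inv ≫ (ε_ P A) ▷ M ≫ (λ_ M).hom) =
      𝟙 ((ihom A).obj M) := by
    apply MonoidalClosed.uncurry_injective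
    rw [MonoidalClosed.uncurry_natural_left, MonoidalClosed.uncurry_natural_left,
      MonoidalClosed.uncurry_natural_left, MonoidalClosed.uncurry_natural_left,
      MonoidalClosed.uncurry_curry, MonoidalClosed.uncurry_id_eq_ev]
    have gen {W : C} (ev : A ⊗ W ⟶ M) : A ◁ (λ_ W).inv ≫ A ◁ (η_ P A ▷ W) ≫
        A ◁ (α_ P A W).hom ≫ A ◁ (P ◁ ev) ≫ (α_ A P M).inv ≫ (ε_ P A) ▷ M ≫ (λ_ M).hom =
        ev := by
      have e := congrArg (fun t => t ▷ W) (ExactPairing.coevaluation_evaluation P A)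
      simp only [comp_whiskerRight] at e
      rw [associator_inv_naturality_right_assoc, whisker_exchange_assoc, leftUnitor_naturality]
      calc _ = A ◁ (λ_ W).inv ≫ (α_ A (𝟙_ C) W).inv ≫ ((A ◁ η_ P A) ▷ W ≫
            (α_ A P A).inv ▷ W ≫ (ε_ P A ▷ A) ▷ W) ≫ (α_ _ A W).hom ≫ (λ_ _).hom ≫ ev := by
              monoidal
        _ = ev := by
            rw [e]
            monoidal
    exact gen _
  rw [← curry_cancel_aux _ _ hθ x, ← curry_cancel_aux _ _ hθ y]
  exact congrArg (fun t => (λ_ X).inv ≫ (η_ P A) ▷ X ≫ (α_ P A X).hom ≫ P ◁ t ≫ _) h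

section

variable {H : C} [BimonObj H] [HLinearBraiding H]

theorem leftMul_coact (M : ComodAlg H) {A : C} (i : A ⟶ M.X)
    (hi : i ≫ M.coact = (ρ_ A).inv ≫ (i ⊗ₘ η[H])) :
    leftMul i ≫ M.coact = A ◁ M.coact ≫ (α_ A M.X H).inv ≫ leftMul i ▷ H := by
  have e : i ▷ M.X ≫ (M.coact ⊗ₘ M.coact) =
      A ◁ M.coact ≫ (ρ_ A).inv ▷ (M.X ⊗ H) ≫ (i ⊗ₘ η[H]) ▷ (M.X ⊗ H) := by
    rw [← comp_whiskerRight, ← hi, MonoidalCategory.tensorHom_def, comp_whiskerRight,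
      whisker_exchange_assoc, whisker_exchange]
  rw [leftMul, Category.assoc, IsMonHom.mul_hom, reassoc_of% e, MonObj.tensorObj.mul_def,
    tensorμ_natural_left_assoc, tensorHom_comp_tensorHom, MonObj.one_mul]
  simp only [tensorμ, MonoidalCategory.tensorHom_def', braiding_tensorUnit_left]
  monoidal

theorem rightMul_coact (M : ComodAlg H) {A : C} (i : A ⟶ M.X)
    (hi : i ≫ M.coact = (ρ_ A).inv ≫ (i ⊗ₘ η[H])) :
    rightMul i ≫ M.coact = A ◁ M.coact ≫ (α_ A M.X H).inv ≫ rightMul i ▷ H := by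
  have e : (β_ A M.X).hom ≫ M.X ◁ i ≫ (M.coact ⊗ₘ M.coact) =
      A ◁ M.coact ≫ (β_ A (M.X ⊗ H)).hom ≫ (M.X ⊗ H) ◁ (ρ_ A).inv ≫
        (M.X ⊗ H) ◁ (i ⊗ₘ η[H]) := by
    rw [← whiskerLeft_comp, ← hi, MonoidalCategory.tensorHom_def', whiskerLeft_comp,
      BraidedCategory.braiding_naturality_right_assoc, whisker_exchange,
      whisker_exchange_assoc]
  rw [rightMul, Category.assoc, Category.assoc, IsMonHom.mul_hom, reassoc_of% e,
    MonObj.tensorObj.mul_def,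
    tensorμ_natural_right_assoc, tensorHom_comp_tensorHom, MonObj.mul_one,
    BraidedCategory.braiding_tensor_right_hom]
  have e₁ : (M.X ⊗ H) ◁ (ρ_ A).inv ≫ tensorμ M.X H A (𝟙_ C) ≫
      (M.X ◁ i ≫ μ[M.X] ⊗ₘ (ρ_ H).hom) = (α_ M.X H A).hom ≫ M.X ◁ (β_ H A).hom ≫
        (α_ M.X A H).inv ≫ (M.X ◁ i ≫ μ[M.X]) ▷ H := by
    simp [tensorμ, MonoidalCategory.tensorHom_def']
  have e₂ : (β_ A H).hom ≫ (β_ H A).hom = 𝟙 _ := by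
    rw [← cancel_epi (β_ H A).hom, ← Category.assoc, braiding_symm]
    simp
  simp only [e₁, Category.assoc, Iso.inv_hom_id_assoc]
  rw [← whiskerLeft_comp_assoc M.X, e₂]
  simp

variable [MonoidalClosed C] [HasEqualizers C] [IsFlat H]

/-- The subalgebra `M^A` of a comodule algebra `M`, for a morphism `i : A ⟶ M` with coinvariant
image: the equalizer of the two morphisms from `M` to the inner hom object `[A, M]` that correspond
to left multiplication by `A` and to right multiplication by `A` preceded by the braiding. -/
noncomputable def commutant (M : ComodAlg H) {A : C} (hA : IsFinite A) (i : A ⟶ M.X)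
    (hi : i ≫ M.coact = (ρ_ A).inv ≫ (i ⊗ₘ η[H])) : ComodAlg H :=
  have h : A ◁ equalizer.ι (MonoidalClosed.curry (leftMul i)) (MonoidalClosed.curry (rightMul i)) ≫
        leftMul i =
      A ◁ equalizer.ι (MonoidalClosed.curry (leftMul i)) (MonoidalClosed.curry (rightMul i)) ≫
        rightMul i := by
    apply MonoidalClosed.curry_injective
    rw [MonoidalClosed.curry_natural_left, MonoidalClosed.curry_natural_left, equalizer.condition]
  subComodAlg M (MonoidalClosed.curry (leftMul i)) (MonoidalClosed.curry (rightMul i))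
    (by rw [← MonoidalClosed.curry_natural_left, one_leftMul, MonoidalClosed.curry_natural_left])
    (by
      rw [← Category.assoc, ← MonoidalClosed.curry_natural_left, leftMul_comm i _ h,
        MonoidalClosed.curry_natural_left, Category.assoc])
    (by
      apply curry_cancel hA
      have e (t : A ⊗ M.X ⟶ M.X) : A ◁ (MonoidalClosed.curry t) ▷ H ≫ (α_ A _ H).inv ≫
          (ihom.ev A).app M.X ▷ H = (α_ A M.X H).inv ≫ t ▷ H := by
        rw [associator_inv_naturality_middle_assoc, ← comp_whiskerRight,
          ← MonoidalClosed.uncurry_eq, MonoidalClosed.uncurry_curry]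
      simp only [whiskerLeft_comp, Category.assoc]
      rw [e, e, ← leftMul_coact M i hi, ← rightMul_coact M i hi, reassoc_of% h])

/-- The comodule algebra `(A # H)^A` of an `H`-module algebra `A` that is finite in `C`. -/
noncomputable def smashCommutant (A : Mod C H) [MonObj A] (hA : IsFinite A.X) : ComodAlg H :=
  commutant (smash A) hA (smashIncl A) (smashIncl_coact A)

end

end Invariants

/-! ### The cotensor product -/

section Cotensor

variable {H : C} [BimonObj H]

/-- The tensor product of two comodule algebras, with the coaction of the second factor. -/
@[reducible]
def tensorComodAlg (S T : ComodAlg H) : ComodAlg H where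
  X := S.X ⊗ T.X
  coact := S.X ◁ T.coact ≫ (α_ S.X T.X H).inv
  coact_counit := by
    rw [Category.assoc, ← associator_inv_naturality_right, ← whiskerLeft_comp_assoc,
      T.coact_counit]
    monoidal
  coact_coassoc := by
    rw [Category.assoc, ← associator_inv_naturality_right, ← whiskerLeft_comp_assoc,
      T.coact_coassoc]
    monoidal

/-- The left coaction `T ⟶ H ⊗ T` obtained from the right coaction by the braiding. -/
def leftCoact (T : ComodAlg H) : T.X ⟶ H ⊗ T.X := T.coact ≫ (β_ T.X H).hom

variable [HLinearBraiding H]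

instance isMonHom_braiding (T : C) [MonObj T] : IsMonHom (β_ T H).hom where
  one_hom := MonObj.one_braiding T H
  mul_hom := by
    dsimp [MonObj.tensorObj.mul_def]
    simp only [tensorμ, Category.assoc, BraidedCategory.braiding_naturality,
      BraidedCategory.braiding_tensor_right_hom, BraidedCategory.braiding_tensor_left_hom,
      comp_whiskerRight, whisker_assoc, whiskerLeft_comp, pentagon_assoc,
      pentagon_inv_hom_hom_hom_inv_assoc, Iso.inv_hom_id_assoc, whiskerLeft_hom_inv_assoc]
    rw [← whiskerLeft_comp_assoc T ((β_ H T).hom ▷ H), ← comp_whiskerRight, braiding_symm]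
    simp only [id_whiskerRight, whiskerLeft_id, Category.id_comp, Category.assoc,
      pentagon_inv_assoc, Iso.hom_inv_id_assoc]
    rw [← associator_inv_naturality_left_assoc, Iso.inv_hom_id_assoc,
      ← associator_naturality_right_assoc, ← MonoidalCategory.tensorHom_def_assoc]

instance (T : ComodAlg H) : IsMonHom (leftCoact T) := by
  unfold leftCoact
  infer_instance

theorem leftCoact_coact (T : ComodAlg H) :
    leftCoact T ≫ H ◁ T.coact = T.coact ≫ leftCoact T ▷ H ≫ (α_ H T.X H).hom := by
  have h := T.coact_coassoc
  have h' : T.coact ≫ T.coact ▷ H = T.coact ≫ T.X ◁ Δ[H] ≫ (α_ T.X H H).inv := by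
    rw [reassoc_of% h, Iso.hom_inv_id, Category.comp_id]
  rw [leftCoact, Category.assoc, ← BraidedCategory.braiding_naturality_left,
    comp_whiskerRight, Category.assoc, reassoc_of% h', reassoc_of% h',
    BraidedCategory.braiding_tensor_left_hom]
  simp only [Iso.inv_hom_id_assoc]
  rw [← whiskerLeft_comp_assoc, cocomm]

variable [HasEqualizers C] [IsFlat H]

/-- The cotensor product `S □ T` over `H`: the equalizer of `ρ ⊗ T` and `S ⊗ λ` on `S ⊗ T`, where
`ρ` is the right coaction on `S` and `λ` the left coaction on `T`. It is a subalgebra of the tensor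
product algebra, with the coaction of `T`. -/
noncomputable def cotensor (S T : ComodAlg H) : ComodAlg H :=
  subComodAlg (tensorComodAlg S T) (S.coact ▷ T.X) (S.X ◁ leftCoact T ≫ (α_ S.X H T.X).inv)
    (by rw [IsMonHom.one_hom, IsMonHom.one_hom])
    (by
      rw [IsMonHom.mul_hom, IsMonHom.mul_hom, tensorHom_comp_tensorHom_assoc,
        tensorHom_comp_tensorHom_assoc, equalizer.condition])
    (by
      have e₁ : (tensorComodAlg S T).coact ≫ (S.coact ▷ T.X) ▷ H =
          S.coact ▷ T.X ≫ (S.X ⊗ H) ◁ T.coact ≫ (α_ _ T.X H).inv := by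
        rw [← whisker_exchange_assoc, Category.assoc]
        simp
      have e₂ : (tensorComodAlg S T).coact ≫ (S.X ◁ leftCoact T ≫ (α_ S.X H T.X).inv) ▷ H =
          (S.X ◁ leftCoact T ≫ (α_ S.X H T.X).inv) ≫ (S.X ⊗ H) ◁ T.coact ≫
            (α_ _ T.X H).inv := by
        have h := congrArg (fun t => S.X ◁ t) (leftCoact_coact T)
        simp only [whiskerLeft_comp] at h
        rw [Category.assoc, Category.assoc, ← associator_inv_naturality_right_assoc, reassoc_of% h]
        monoidal
      rw [e₁, e₂, equalizer.condition_assoc])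

end Cotensor

/-! ### Azumaya algebras -/

section Azumaya

/-- The morphism `X ⟶ P ⊗ Y` adjoint to `f : A ⊗ X ⟶ Y`, where `P` is dual to `A`, so that
`P ⊗ Y` is the inner hom object `[A, Y]`. -/
def transposeDual {A P X Y : C} [ExactPairing P A] (f : A ⊗ X ⟶ Y) : X ⟶ P ⊗ Y :=
  (λ_ X).inv ≫ (η_ P A) ▷ X ≫ (α_ P A X).hom ≫ P ◁ f

/-- Evaluation `A ⊗ P ⟶ 𝟙`, with `P = [A, 𝟙]`, coequalizes the two morphisms
`A ⊗ [A, A] ⊗ P ⟶ A ⊗ P` given by the actions of `[A, A] = P ⊗ A` on `A` and on `P`. -/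
theorem evaluation_balanced (A P : C) [ExactPairing P A] :
    (ε_ P A ▷ (A ⊗ P) ≫ (λ_ (A ⊗ P)).hom) ≫ ε_ P A =
      ((A ⊗ P) ◁ ε_ P A ≫ (ρ_ (A ⊗ P)).hom) ≫ ε_ P A := by
  rw [Category.assoc, Category.assoc, ← leftUnitor_naturality, ← rightUnitor_naturality,
    ← whisker_exchange_assoc, unitors_equal]

/-- The object `A` with dual `P` is a progenerator: evaluation induces an isomorphism from
`A ⊗_{[A, A]} P` to the unit object. -/
def IsProgenerator (A P : C) [ExactPairing P A] : Prop :=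
  Nonempty (IsColimit (Cofork.ofπ (ε_ P A) (evaluation_balanced A P)))

/-- The canonical morphism from `A ⊗ Aᵒᵖ` to `[A, A] = P ⊗ A`, adjoint to
`a ⊗ b ⊗ c ↦ a (c b)`, where `b` passes `c` by the braiding. -/
def azumayaLeft (A P : C) [MonObj A] [ExactPairing P A] : A ⊗ A ⟶ P ⊗ A :=
  transposeDual ((β_ A (A ⊗ A)).hom ≫ (α_ A A A).hom ≫ A ◁ (β_ A A).hom ≫ A ◁ μ[A] ≫ μ[A])

/-- The canonical morphism from `Aᵒᵖ ⊗ A` to `[A, A] = P ⊗ A`, adjoint to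
`c ⊗ a ⊗ b ↦ (a c) b`, where `c` passes `a` by the braiding. -/
def azumayaRight (A P : C) [MonObj A] [ExactPairing P A] : A ⊗ A ⟶ P ⊗ A :=
  transposeDual ((α_ A A A).inv ≫ (β_ A A).hom ▷ A ≫ μ[A] ▷ A ≫ μ[A])

/-- An algebra `A` in a braided monoidal category is Azumaya if it is faithfully projective and the
canonical morphisms from `A ⊗ Aᵒᵖ` and `Aᵒᵖ ⊗ A` to `[A, A]` are isomorphisms. -/
def IsAzumayaAlg (A : C) [MonObj A] : Prop :=
  ∃ (P : C) (_ : ExactPairing P A),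
    IsProgenerator A P ∧ IsIso (azumayaLeft A P) ∧ IsIso (azumayaRight A P)

/-- The underlying object of an `H`-Azumaya algebra, that is, of an Azumaya algebra in the braided
monoidal category of left `H`-modules, is finite in `C`. -/
theorem IsAzumayaAlg.isFinite {H : C} [BimonObj H] [HLinearBraiding H] {A : Mod C H} [MonObj A]
    (hA : IsAzumayaAlg A) : IsFinite A.X := by
  obtain ⟨P, p, -⟩ := hA
  exact ⟨P.X, ⟨{
    coevaluation' := (η_ P A).hom
    evaluation' := (ε_ P A).hom
    coevaluation_evaluation' :=
      congrArg Mod.Hom.hom (ExactPairing.coevaluation_evaluation P A)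
    evaluation_coevaluation' :=
      congrArg Mod.Hom.hom (ExactPairing.evaluation_coevaluation P A) }⟩⟩

/-- The underlying object of the tensor product of two `H`-Azumaya algebras is finite in `C`. -/
theorem IsAzumayaAlg.isFinite_tensor {H : C} [BimonObj H] [HLinearBraiding H] {A B : Mod C H}
    [MonObj A] [MonObj B] (hA : IsAzumayaAlg A) (hB : IsAzumayaAlg B) : IsFinite (A ⊗ B).X :=
  hA.isFinite.tensor hB.isFinite

end Azumaya

end BraidedHopf

open BraidedHopf

/-!
If the left canonical morphism of `A` is an isomorphism, then every algebra `M` with an algebra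
morphism `A ⟶ M` is the free left `A`-module on the centralizer of `A` in `M`: dual bases of `A` are
realized by elements of `A ⊗ Aᵒᵖ`, and the rank one elements of `A ⊗ Aᵒᵖ` project `M` onto the
centralizer. Hence `A # H` is free over `A` on two objects, `H` and `(A # H)^A`. The canonical
morphism of `A # H` is, in the basis `H`, inverted by the antipode; in the basis `(A # H)^A` it is
the extension of scalars of the canonical morphism of `(A # H)^A`, and faithful flatness descends
along `A ⊗ (A # H)^A ≅ A ⊗ H`. This makes `(A # H)^A` a Galois object.

The morphism `(a ⊗ b) # h ↦ (a # h₁) ⊗ (b # h₂)` identifies `(A ⊗ B) # H` with the cotensor product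
of `A # H` and `B # H`. Inside `(A # H) ⊗ (B # H)` the centralizer of `A ⊗ B` is
`(A # H)^A ⊗ (B # H)^B`, so its balanced part is at the same time the centralizer of `A ⊗ B` in
`(A ⊗ B) # H` and the cotensor product of `(A # H)^A` and `(B # H)^B`. As `A ⊗ B` is flat, tensoring
this cotensor product with `A ⊗ B` gives `(A ⊗ B) # H`, and the argument for `A # H` shows that it
is a Galois object.
-/

namespace BraidedHopf

section Category

variable {C : Type u} [Category.{v} C]

theorem reflectsIsomorphisms_of_strongEpi_app {F : C ⥤ C} (α : F ⟶ 𝟭 C)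
    [∀ X, StrongEpi (α.app X)] : F.ReflectsIsomorphisms where
  reflects {X Y} f _ := by
    have : Mono f := ⟨fun {W} u w h => by
      have hF : F.map u = F.map w := by
        rw [← cancel_mono (F.map f), ← F.map_comp, h, F.map_comp]
      have hα := α.naturality u
      rw [hF, α.naturality w, cancel_epi] at hα
      exact hα.symm⟩
    have : StrongEpi ((inv (F.map f) ≫ α.app X) ≫ f) := by
      have h : (inv (F.map f) ≫ α.app X) ≫ f = α.app Y := by
        rw [Category.assoc, IsIso.inv_comp_eq]
        exact (α.naturality f).symm
      rw [h]
      infer_instance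
    have := strongEpi_of_strongEpi (inv (F.map f) ≫ α.app X) f
    exact isIso_of_mono_of_strongEpi f

theorem isIso_of_isLimit_fork {X Y X' Y' U U' : C}
    {f g : X ⟶ Y} {f' g' : X' ⟶ Y'}
    {i : U ⟶ X} {w : i ≫ f = i ≫ g} (h : IsLimit (Fork.ofι i w)) {i' : U' ⟶ X'} [Mono i']
    (w' : i' ≫ f' = i' ≫ g') {a : X ⟶ X'} [IsIso a] {b : Y ⟶ Y'} [Mono b]
    (hf : a ≫ f' = f ≫ b) (hg : a ≫ g' = g ≫ b) {θ : U ⟶ U'} (hθ : θ ≫ i' = i ≫ a) : IsIso θ := by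
  have : Mono i := mono_of_isLimit_fork h
  have equalizes : (i' ≫ inv a) ≫ f = (i' ≫ inv a) ≫ g := by
    simp only [← cancel_mono b, Category.assoc, ← hf, ← hg, IsIso.inv_hom_id_assoc, w']
  have lift_comp : Fork.IsLimit.lift h (i' ≫ inv a) equalizes ≫ i = i' ≫ inv a :=
    Fork.IsLimit.lift_ι' h _ _
  refine ⟨Fork.IsLimit.lift h (i' ≫ inv a) equalizes, ?_, ?_⟩
  · rw [← cancel_mono i, Category.assoc, lift_comp, reassoc_of% hθ, IsIso.hom_inv_id,
      Category.comp_id, Category.id_comp]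
  · rw [← cancel_mono i', Category.assoc, hθ, reassoc_of% lift_comp, IsIso.inv_hom_id,
      Category.comp_id, Category.id_comp]

end Category

variable {C : Type u} [Category.{v} C] [MonoidalCategory C]

section LeftMultiplication

variable {A B M N : C} [MonObj M] [MonObj N]

theorem leftMul_precomp (f : B ⟶ A) (i : A ⟶ M) : leftMul (f ≫ i) = f ▷ M ≫ leftMul i := by
  simp [leftMul]

theorem leftMul_postcomp (i : A ⟶ M) (f : M ⟶ N) [IsMonHom f] :
    A ◁ f ≫ leftMul (i ≫ f) = leftMul i ≫ f := by
  simp only [leftMul, comp_whiskerRight, Category.assoc, IsMonHom.mul_hom,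
    MonoidalCategory.tensorHom_def']
  rw [whisker_exchange_assoc, whisker_exchange_assoc]

theorem isMonHom_of_leftMul [MonObj A] {i : A ⟶ M} (one : η[A] ≫ i = η[M])
    (mul : A ◁ i ≫ leftMul i = μ[A] ≫ i) : IsMonHom i where
  one_hom := one
  mul_hom := by
    rw [← mul, leftMul, MonoidalCategory.tensorHom_def', Category.assoc]

variable [MonObj A] (i : A ⟶ M) [IsMonHom i]

theorem one_leftMul_act : η[A] ▷ M ≫ leftMul i = (λ_ M).hom := by
  rw [← leftMul_precomp, IsMonHom.one_hom, leftMul, MonObj.one_mul]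

theorem leftMul_leftMul :
    A ◁ leftMul i ≫ leftMul i = (α_ A A M).inv ≫ μ[A] ▷ M ≫ leftMul i := by
  have h := MonObj.mul_assoc M
  rw [← leftMul_precomp, IsMonHom.mul_hom, leftMul, leftMul]
  simp only [comp_whiskerRight, Category.assoc, whiskerLeft_comp, MonoidalCategory.tensorHom_def]
  rw [whisker_exchange_assoc, whisker_exchange_assoc, h]
  simp

end LeftMultiplication

section LinearExtension

variable {S X Y Z : C} [MonObj S]

/-- The `S`-linear extension to the free left `S`-module `S ⊗ X` of a morphism `X ⟶ S ⊗ Y`. -/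
def linearExt (f : X ⟶ S ⊗ Y) : S ⊗ X ⟶ S ⊗ Y := S ◁ f ≫ (α_ S S Y).inv ≫ μ[S] ▷ Y

theorem linearExt_one : linearExt ((λ_ X).inv ≫ η[S] ▷ X) = 𝟙 (S ⊗ X) := by
  rw [linearExt, whiskerLeft_comp, Category.assoc, associator_inv_naturality_middle_assoc,
    ← comp_whiskerRight, MonObj.mul_one]
  simp

theorem linearExt_comp (f : X ⟶ S ⊗ Y) (g : Y ⟶ S ⊗ Z) :
    linearExt f ≫ linearExt g = linearExt (f ≫ linearExt g) := by
  simp only [linearExt, whiskerLeft_comp, Category.assoc]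
  rw [← whisker_exchange_assoc, associator_inv_naturality_left_assoc, ← comp_whiskerRight,
    MonObj.mul_assoc]
  monoidal

theorem isIso_linearExt {f : X ⟶ S ⊗ Y} {g : Y ⟶ S ⊗ X}
    (hfg : f ≫ linearExt g = (λ_ X).inv ≫ η[S] ▷ X)
    (hgf : g ≫ linearExt f = (λ_ Y).inv ≫ η[S] ▷ Y) : IsIso (linearExt f) :=
  ⟨linearExt g, by rw [linearExt_comp, hfg, linearExt_one],
    by rw [linearExt_comp, hgf, linearExt_one]⟩

end LinearExtension

section ChangeOfBasis

variable {A S X Y : C} [MonObj A] [MonObj S] (i : A ⟶ S)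

/-- The coordinates of `p : X ⟶ S` with respect to a basis `q : Y ⟶ S` of `S` as a left
`A`-module. -/
noncomputable def coords (p : X ⟶ S) (q : Y ⟶ S) [IsIso (A ◁ q ≫ leftMul i)] : X ⟶ A ⊗ Y :=
  p ≫ inv (A ◁ q ≫ leftMul i)

variable [IsMonHom i]

theorem linearExt_act (f : X ⟶ A ⊗ Y) (q : Y ⟶ S) :
    linearExt f ≫ A ◁ q ≫ leftMul i = A ◁ (f ≫ A ◁ q ≫ leftMul i) ≫ leftMul i := by
  simp only [linearExt, whiskerLeft_comp, Category.assoc]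
  rw [leftMul_leftMul, ← whisker_exchange_assoc, associator_inv_naturality_right_assoc]

theorem linearExt_whiskerRight (f : X ⟶ A ⊗ Y) :
    i ▷ X ≫ linearExt (f ≫ i ▷ Y) = linearExt f ≫ i ▷ Y := by
  rw [linearExt, linearExt, ← whisker_exchange_assoc]
  simp only [Category.assoc, whiskerLeft_comp, ← comp_whiskerRight, IsMonHom.mul_hom,
    MonoidalCategory.tensorHom_def']
  simp

variable (p : X ⟶ S) (q : Y ⟶ S) [IsIso (A ◁ p ≫ leftMul i)] [IsIso (A ◁ q ≫ leftMul i)]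

theorem coords_linearExt_coords :
    coords i p q ≫ linearExt (coords i q p) = (λ_ X).inv ≫ η[A] ▷ X := by
  have h {X Y : C} (p : X ⟶ S) (q : Y ⟶ S) [IsIso (A ◁ q ≫ leftMul i)] :
      coords i p q ≫ A ◁ q ≫ leftMul i = p := by
    simp [coords]
  rw [← cancel_mono (A ◁ p ≫ leftMul i), Category.assoc, linearExt_act, h, h]
  simp [← whisker_exchange_assoc, one_leftMul_act]

theorem isIso_linearExt_coords : IsIso (linearExt (coords i p q ≫ i ▷ Y)) := by
  have h {X Y : C} (p : X ⟶ S) (q : Y ⟶ S) [IsIso (A ◁ p ≫ leftMul i)]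
      [IsIso (A ◁ q ≫ leftMul i)] : (coords i p q ≫ i ▷ Y) ≫ linearExt (coords i q p ≫ i ▷ X) =
        (λ_ X).inv ≫ η[S] ▷ X := by
    rw [Category.assoc, linearExt_whiskerRight, reassoc_of% coords_linearExt_coords i p q,
      ← comp_whiskerRight, IsMonHom.one_hom]
  exact isIso_linearExt (h p q) (h q p)

end ChangeOfBasis

/-! ### Flat objects -/

section Reflection

theorem tensorLeft_reflectsIsomorphisms_of_strongEpi {X : C} (q : X ⟶ 𝟙_ C)
    [∀ Y : C, StrongEpi (q ▷ Y)] : (tensorLeft X).ReflectsIsomorphisms :=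
  let α : tensorLeft X ⟶ 𝟭 C :=
    { app Y := q ▷ Y ≫ (λ_ Y).hom
      naturality Y Z f := by simp [whisker_exchange_assoc] }
  have (Y : C) : StrongEpi (α.app Y) := inferInstanceAs (StrongEpi (q ▷ Y ≫ (λ_ Y).hom))
  reflectsIsomorphisms_of_strongEpi_app α

theorem tensorLeft_reflectsIsomorphisms_of_iso {X Y : C} (e : X ≅ Y)
    [(tensorLeft X).ReflectsIsomorphisms] : (tensorLeft Y).ReflectsIsomorphisms :=
  reflectsIsomorphisms_of_iso ((curriedTensor C).mapIso e)

instance tensorLeft_tensor_reflectsIsomorphisms (X Y : C) [(tensorLeft X).ReflectsIsomorphisms]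
    [(tensorLeft Y).ReflectsIsomorphisms] : (tensorLeft (X ⊗ Y)).ReflectsIsomorphisms :=
  reflectsIsomorphisms_of_iso (tensorLeftTensor X Y).symm

theorem tensorLeft_reflectsIsomorphisms_of_tensor (X Y : C)
    [(tensorLeft (X ⊗ Y)).ReflectsIsomorphisms] : (tensorLeft Y).ReflectsIsomorphisms :=
  have := reflectsIsomorphisms_of_iso (tensorLeftTensor X Y)
  reflectsIsomorphisms_of_comp (tensorLeft Y) (tensorLeft X)

theorem isIso_of_whiskerLeft (X : C) [(tensorLeft X).ReflectsIsomorphisms] {Y Z : C} (f : Y ⟶ Z)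
    [h : IsIso (X ◁ f)] : IsIso f :=
  have : IsIso ((tensorLeft X).map f) := h
  isIso_of_reflects_iso f (tensorLeft X)

end Reflection

section Flatness

theorem IsFlat.tensor (X Y : C) [IsFlat X] [IsFlat Y] : IsFlat (X ⊗ Y) where
  preserves :=
    have := IsFlat.preserves (X := X)
    have := IsFlat.preserves (X := Y)
    preservesLimitsOfShape_of_natIso (tensorLeftTensor X Y).symm

variable [HasEqualizers C]

theorem isFaithfullyFlat_of_reflectsIsomorphisms (X : C) [IsFlat X]
    [(tensorLeft X).ReflectsIsomorphisms] : IsFaithfullyFlat X where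
  reflects :=
    have := IsFlat.preserves (X := X)
    reflectsLimitsOfShape_of_reflectsIsomorphisms

theorem isFaithfullyFlat_of_iso {A T Y : C} [IsFlat A] [IsFlat Y]
    [(tensorLeft A).ReflectsIsomorphisms] [(tensorLeft Y).ReflectsIsomorphisms]
    (e : A ⊗ T ≅ A ⊗ Y) : IsFaithfullyFlat T := by
  have : IsFlat T := ⟨by
    have := (IsFlat.tensor A Y).preserves
    have := (isFaithfullyFlat_of_reflectsIsomorphisms A).reflects
    have : PreservesLimitsOfShape WalkingParallelPair (tensorLeft T ⋙ tensorLeft A) :=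
      preservesLimitsOfShape_of_natIso
        ((curriedTensor C).mapIso e.symm ≪≫ tensorLeftTensor A T)
    exact preservesLimitsOfShape_of_reflects_of_preserves (tensorLeft T) (tensorLeft A)⟩
  have := tensorLeft_reflectsIsomorphisms_of_iso e.symm
  have := tensorLeft_reflectsIsomorphisms_of_tensor A T
  exact isFaithfullyFlat_of_reflectsIsomorphisms T

end Flatness

theorem comp_transposeDual {A P : C} [ExactPairing P A] {X X' Y : C} (x : X' ⟶ X) (f : A ⊗ X ⟶ Y) :
    x ≫ transposeDual (P := P) f = transposeDual (A ◁ x ≫ f) :=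
  (tensorLeftHomEquiv X' P A Y).symm_apply_eq.1 <|
    (tensorLeftHomEquiv_symm_naturality x (tensorLeftHomEquiv X P A Y f)).trans <| by
      rw [Equiv.symm_apply_apply]

variable [BraidedCategory C]

/-! ### Centralizers of Azumaya algebras -/

section RightMultiplication

variable {A B M N : C} [MonObj M] [MonObj N]

theorem rightMul_precomp (f : B ⟶ A) (i : A ⟶ M) : rightMul (f ≫ i) = f ▷ M ≫ rightMul i := by
  simp [rightMul]

theorem rightMul_postcomp (i : A ⟶ M) (f : M ⟶ N) [IsMonHom f] :
    A ◁ f ≫ rightMul (i ≫ f) = rightMul i ≫ f := by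
  simp only [rightMul, whiskerLeft_comp, Category.assoc, IsMonHom.mul_hom,
    MonoidalCategory.tensorHom_def]
  rw [BraidedCategory.braiding_naturality_right_assoc, whisker_exchange_assoc]

theorem rightMul_leftMul (i : A ⟶ M) : A ◁ leftMul i ≫ rightMul i =
    (α_ A A M).inv ≫ (β_ A A).hom ▷ M ≫ (α_ A A M).hom ≫ A ◁ rightMul i ≫ leftMul i := by
  simp only [leftMul, whiskerLeft_comp, Category.assoc]
  rw [mul_rightMul, associator_inv_naturality_middle_assoc, ← comp_whiskerRight_assoc,
    BraidedCategory.braiding_naturality_right, whisker_exchange_assoc]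
  simp

variable [MonObj A] (i : A ⟶ M) [IsMonHom i]

theorem one_rightMul_act : η[A] ▷ M ≫ rightMul i = (λ_ M).hom := by
  rw [← rightMul_precomp, IsMonHom.one_hom, rightMul, MonObj.mul_one, braiding_rightUnitor]

theorem rightMul_rightMul : A ◁ rightMul i ≫ rightMul i =
    (α_ A A M).inv ≫ ((β_ A A).hom ≫ μ[A]) ▷ M ≫ rightMul i := by
  have e : A ◁ i ≫ rightMul i = (β_ A A).hom ≫ μ[A] ≫ i := by
    rw [rightMul, BraidedCategory.braiding_naturality_right_assoc, IsMonHom.mul_hom,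
      MonoidalCategory.tensorHom_def, Category.assoc]
  calc A ◁ rightMul i ≫ rightMul i
    _ = A ◁ (β_ A M).hom ≫ (α_ A M A).inv ≫ (β_ A M).hom ▷ A ≫ (α_ M A A).hom ≫
          M ◁ (A ◁ i ≫ rightMul i) ≫ μ[M] := by
      nth_rw 1 [rightMul]
      simp only [whiskerLeft_comp, Category.assoc]
      rw [mul_rightMul, associator_inv_naturality_right_assoc, whisker_exchange_assoc,
        associator_naturality_right_assoc]
    _ = _ := by
      rw [e, rightMul, BraidedCategory.braiding_naturality_left_assoc,
        BraidedCategory.braiding_tensor_left_hom]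
      simp only [whiskerLeft_comp, Category.assoc, Iso.inv_hom_id_assoc]

end RightMultiplication

section Centralizers

variable {A M X : C} [MonObj M]

/-- The morphism `x : X ⟶ M` centralizes `i : A ⟶ M`: the left and the right multiplication by `A`
through `i` agree on `x`, the right one preceded by the braiding. -/
def Centralizes (i : A ⟶ M) (x : X ⟶ M) : Prop := A ◁ x ≫ leftMul i = A ◁ x ≫ rightMul i

/-- The morphism `j : T ⟶ M` exhibits `T` as the centralizer of `i : A ⟶ M`: it is universal among
the morphisms that centralize `i`. -/
structure IsCentralizer {T : C} (i : A ⟶ M) (j : T ⟶ M) : Prop where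
  mono : Mono j
  centralizes : Centralizes i j
  exists_lift {X : C} (x : X ⟶ M) (hx : Centralizes i x) : ∃ y, y ≫ j = x

namespace Centralizes

variable {i : A ⟶ M} {x : X ⟶ M}

theorem precomp_left {B : C} (h : Centralizes i x) (f : B ⟶ A) : Centralizes (f ≫ i) x := by
  rw [Centralizes, leftMul_precomp, rightMul_precomp, whisker_exchange_assoc,
    whisker_exchange_assoc, h]

theorem precomp_right {Y : C} (h : Centralizes i x) (g : Y ⟶ X) : Centralizes i (g ≫ x) := by
  rw [Centralizes, whiskerLeft_comp, Category.assoc, Category.assoc, h]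

end Centralizes

theorem centralizes_postcomp_iff {N : C} [MonObj N] (i : A ⟶ M) (x : X ⟶ M) (f : M ⟶ N)
    [IsMonHom f] [Mono f] : Centralizes (i ≫ f) (x ≫ f) ↔ Centralizes i x := by
  simp only [Centralizes, whiskerLeft_comp, Category.assoc, leftMul_postcomp, rightMul_postcomp]
  simp only [← Category.assoc, cancel_mono]

end Centralizers

section EnvelopingAction

variable {A M : C} [MonObj M]

/-- The action of `A ⊗ Aᵒᵖ` on `M`, `(a ⊗ b) ⊗ m ↦ a (m b)`, where `b` passes `m` by the
braiding. -/
def envAct (i : A ⟶ M) : (A ⊗ A) ⊗ M ⟶ M := (α_ A A M).hom ≫ A ◁ rightMul i ≫ leftMul i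

variable [MonObj A]

variable (A) in
/-- Multiplication by `A` on the first factor of `A ⊗ Aᵒᵖ`. -/
def envLeft : A ⊗ (A ⊗ A) ⟶ A ⊗ A := (α_ A A A).inv ≫ μ[A] ▷ A

variable (A) in
/-- Multiplication by `Aᵒᵖ` on the second factor of `A ⊗ Aᵒᵖ`. -/
def envRight : A ⊗ (A ⊗ A) ⟶ A ⊗ A :=
  (α_ A A A).inv ≫ (β_ A A).hom ▷ A ≫ (α_ A A A).hom ≫ A ◁ ((β_ A A).hom ≫ μ[A])

variable (i : A ⟶ M) [IsMonHom i]

theorem envLeft_act :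
    envLeft A ▷ M ≫ envAct i = (α_ A (A ⊗ A) M).hom ≫ A ◁ envAct i ≫ leftMul i := by
  simp only [envAct, whiskerLeft_comp, Category.assoc, leftMul_leftMul, envLeft,
    comp_whiskerRight]
  rw [associator_naturality_left_assoc, ← whisker_exchange_assoc,
    associator_inv_naturality_right_assoc]
  monoidal

theorem envRight_act :
    envRight A ▷ M ≫ envAct i = (α_ A (A ⊗ A) M).hom ≫ A ◁ envAct i ≫ rightMul i := by
  simp only [envAct, whiskerLeft_comp, Category.assoc, rightMul_leftMul, envRight]
  rw [associator_inv_naturality_right_assoc, whisker_exchange_assoc,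
    associator_naturality_right_assoc, ← whiskerLeft_comp_assoc A (A ◁ rightMul i),
    rightMul_rightMul]
  simp

theorem envAct_one : ((λ_ (𝟙_ C)).inv ≫ (η[A] ⊗ₘ η[A])) ▷ M ≫ envAct i = (λ_ M).hom := by
  rw [envAct, MonoidalCategory.tensorHom_def']
  simp only [comp_whiskerRight, Category.assoc]
  rw [associator_naturality_left_assoc, ← whisker_exchange_assoc, one_leftMul_act,
    associator_naturality_middle_assoc, ← whiskerLeft_comp_assoc, one_rightMul_act]
  monoidal

variable {i} in
/-- Since `j` commutes with `A`, in `a (b j(t)) c` the factor `c` can be moved to the left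
of `j(t)`, where only the action of `A ⊗ Aᵒᵖ` on `A` itself is left. -/
theorem Centralizes.envAct_linear {T : C} {j : T ⟶ M} (h : Centralizes i j) :
    (A ⊗ A) ◁ (A ◁ j ≫ leftMul i) ≫ envAct i =
      (α_ (A ⊗ A) A T).inv ≫ envAct (𝟙 A) ▷ T ≫ A ◁ j ≫ leftMul i := by
  have hr : A ◁ (A ◁ j ≫ leftMul i) ≫ rightMul i =
      (α_ A A T).inv ≫ rightMul (𝟙 A) ▷ T ≫ A ◁ j ≫ leftMul i := by
    rw [whiskerLeft_comp, Category.assoc, rightMul_leftMul,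
      associator_inv_naturality_right_assoc, whisker_exchange_assoc,
      associator_naturality_right_assoc, ← whiskerLeft_comp_assoc, ← h, whiskerLeft_comp,
      Category.assoc, leftMul_leftMul, associator_inv_naturality_right_assoc,
      Iso.hom_inv_id_assoc, whisker_exchange_assoc, rightMul]
    simp
  have hl : A ◁ (A ◁ j ≫ leftMul i) ≫ leftMul i =
      (α_ A A T).inv ≫ leftMul (𝟙 A) ▷ T ≫ A ◁ j ≫ leftMul i := by
    rw [whiskerLeft_comp, Category.assoc, leftMul_leftMul,
      associator_inv_naturality_right_assoc, whisker_exchange_assoc, leftMul]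
    simp [leftMul]
  rw [envAct, associator_naturality_right_assoc, ← whiskerLeft_comp_assoc, hr]
  generalize A ◁ j ≫ leftMul i = t at *
  simp only [whiskerLeft_comp, Category.assoc]
  rw [hl, envAct]
  simp

end EnvelopingAction

/-- The dual pairing with `A` on the other side, obtained from the inverse of the braiding. -/
@[reducible]
def swapPairing (P A : C) [ExactPairing P A] : ExactPairing A P :=
  letI := reverseBraiding C
  BraidedCategory.exactPairing_swap P A

section RankOne

variable {A P : C} [MonObj A]

theorem azumayaLeft_eq_transposeDual [ExactPairing P A] :
    azumayaLeft A P = transposeDual ((β_ A (A ⊗ A)).hom ≫ envAct (𝟙 A)) := by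
  simp [azumayaLeft, envAct, rightMul, leftMul]

theorem eq_of_whiskerRight_envAct_eq (P : C) [ExactPairing P A] [IsIso (azumayaLeft A P)]
    {X : C} {x y : X ⟶ A ⊗ A}
    (h : x ▷ A ≫ envAct (𝟙 A) = y ▷ A ≫ envAct (𝟙 A)) : x = y := by
  rw [← cancel_mono (azumayaLeft A P), azumayaLeft_eq_transposeDual, comp_transposeDual,
    comp_transposeDual, BraidedCategory.braiding_naturality_right_assoc,
    BraidedCategory.braiding_naturality_right_assoc, h]

variable [ExactPairing P A] [IsIso (azumayaLeft A P)]

variable (A P) in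
/-- The element of `A ⊗ Aᵒᵖ` that acts on `A` by `c ↦ p(c) 1`, for `p` in the dual of `A`. -/
noncomputable def rankOne : P ⟶ A ⊗ A := (ρ_ P).inv ≫ P ◁ η[A] ≫ inv (azumayaLeft A P)

theorem rankOne_act :
    rankOne A P ▷ A ≫ envAct (𝟙 A) = (β_ A P).inv ≫ ε_ P A ≫ η[A] := by
  have h : A ◁ azumayaLeft A P ≫ (α_ A P A).inv ≫ ε_ P A ▷ A ≫ (λ_ A).hom =
      (β_ A (A ⊗ A)).hom ≫ envAct (𝟙 A) := by
    rw [azumayaLeft_eq_transposeDual]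
    exact (tensorLeftHomEquiv (A ⊗ A) P A A).symm_apply_apply _
  have e : rankOne A P ≫ azumayaLeft A P = (ρ_ P).inv ≫ P ◁ η[A] := by simp [rankOne]
  rw [← (Iso.inv_comp_eq _).2 h, BraidedCategory.braiding_inv_naturality_left_assoc,
    ← whiskerLeft_comp_assoc, e]
  simp only [Category.assoc, whiskerLeft_comp]
  rw [associator_inv_naturality_right_assoc, whisker_exchange_assoc, leftUnitor_naturality]
  monoidal

theorem rankOne_envLeft_eq_envRight :
    A ◁ rankOne A P ≫ envLeft A = A ◁ rankOne A P ≫ envRight A := by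
  apply eq_of_whiskerRight_envAct_eq P
  rw [comp_whiskerRight, comp_whiskerRight, Category.assoc, Category.assoc, envLeft_act,
    envRight_act, associator_naturality_middle_assoc, associator_naturality_middle_assoc,
    ← whiskerLeft_comp_assoc, ← whiskerLeft_comp_assoc, rankOne_act]
  simp only [whiskerLeft_comp, Category.assoc, one_leftMul]

/-- Dual bases: `∑ aᵢ pᵢ = 1` in `A ⊗ Aᵒᵖ`, where `pᵢ` stands for the rank one element
`c ↦ pᵢ(c) 1`. -/
theorem coevaluation_rankOne :
    (swapPairing P A).coevaluation' ≫ A ◁ rankOne A P ≫ envLeft A =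
      (λ_ (𝟙_ C)).inv ≫ (η[A] ⊗ₘ η[A]) := by
  have snake : (swapPairing P A).coevaluation' ▷ A ≫ (α_ A P A).hom ≫
      A ◁ ((β_ A P).inv ≫ ε_ P A) = (λ_ A).hom ≫ (ρ_ A).inv :=
    (swapPairing P A).evaluation_coevaluation'
  apply eq_of_whiskerRight_envAct_eq P
  rw [envAct_one, comp_whiskerRight, comp_whiskerRight, Category.assoc, Category.assoc,
    envLeft_act, associator_naturality_middle_assoc, ← whiskerLeft_comp_assoc, rankOne_act,
    ← Category.assoc (β_ A P).inv, whiskerLeft_comp, Category.assoc, reassoc_of% snake]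
  simp [leftMul]

section Projection

variable {M : C} [MonObj M] (i : A ⟶ M) [IsMonHom i]

theorem centralizes_rankOne_envAct : Centralizes i (rankOne A P ▷ M ≫ envAct i) := by
  have e := congrArg (fun t => (α_ A P M).inv ≫ t ▷ M ≫ envAct i)
    (rankOne_envLeft_eq_envRight (A := A) (P := P))
  simpa [envLeft_act, envRight_act, Centralizes] using e

theorem coevaluation_rankOne_envAct :
    (λ_ M).inv ≫ (swapPairing P A).coevaluation' ▷ M ≫ (α_ A P M).hom ≫
      A ◁ (rankOne A P ▷ M ≫ envAct i) ≫ leftMul i = 𝟙 M := by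
  have e : (swapPairing P A).coevaluation' ▷ M ≫ (α_ A P M).hom ≫
      A ◁ (rankOne A P ▷ M ≫ envAct i) ≫ leftMul i =
        ((swapPairing P A).coevaluation' ≫ A ◁ rankOne A P ≫ envLeft A) ▷ M ≫ envAct i := by
    simp [envLeft_act]
  rw [e, coevaluation_rankOne, envAct_one, Iso.inv_hom_id]

variable {i} in
theorem Centralizes.rankOne_envAct {T : C} {j : T ⟶ M} (h : Centralizes i j) :
    P ◁ (A ◁ j ≫ leftMul i) ≫ rankOne A P ▷ M ≫ envAct i =
      ((α_ P A T).inv ≫ ((β_ A P).inv ≫ ε_ P A) ▷ T ≫ (λ_ T).hom) ≫ j := by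
  rw [whisker_exchange_assoc, h.envAct_linear, associator_inv_naturality_left_assoc,
    ← comp_whiskerRight_assoc, rankOne_act]
  simp only [comp_whiskerRight, Category.assoc]
  rw [← whisker_exchange_assoc, one_leftMul_act, leftUnitor_naturality]

end Projection

end RankOne

/-- With dual bases `aᵢ`, `pᵢ` of `A`, every `m` in `M` is the sum of the `aᵢ (pᵢ m)`, and all the
`pᵢ m` lie in the centralizer. -/
theorem IsCentralizer.isIso_leftMul {A M T : C} (P : C) [MonObj A] [MonObj M] [ExactPairing P A]
    [IsIso (azumayaLeft A P)] {i : A ⟶ M} [IsMonHom i] {j : T ⟶ M} (h : IsCentralizer i j) :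
    IsIso (A ◁ j ≫ leftMul i) := by
  obtain ⟨y, hy⟩ := h.exists_lift _ (centralizes_rankOne_envAct (P := P) i)
  have := h.mono
  have hyT : P ◁ (A ◁ j ≫ leftMul i) ≫ y =
      (α_ P A T).inv ≫ ((β_ A P).inv ≫ ε_ P A) ▷ T ≫ (λ_ T).hom := by
    rw [← cancel_mono j, Category.assoc, hy, h.centralizes.rankOne_envAct]
  refine ⟨(λ_ M).inv ≫ (swapPairing P A).coevaluation' ▷ M ≫ (α_ A P M).hom ≫ A ◁ y, ?_, ?_⟩
  · rw [leftUnitor_inv_naturality_assoc, whisker_exchange_assoc,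
      associator_naturality_right_assoc, ← whiskerLeft_comp, hyT]
    let := swapPairing P A
    have snake := (tensorLeftHomEquiv (A ⊗ T) A P T).apply_symm_apply (𝟙 _)
    simp only [tensorLeftHomEquiv, Equiv.coe_fn_mk, Equiv.coe_fn_symm_mk, whiskerLeft_id,
      Category.id_comp] at snake
    exact snake
  · simp only [Category.assoc]
    rw [← whiskerLeft_comp_assoc, hy, coevaluation_rankOne_envAct]

/-! ### Azumaya algebras of `H`-modules -/

instance bimon_reflectsIsomorphisms (H : C) [BimonObj H] : (tensorLeft H).ReflectsIsomorphisms :=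
  have (Y : C) : IsSplitEpi (ε[H] ▷ Y) :=
    .mk' ⟨η[H] ▷ Y, by rw [← comp_whiskerRight, BimonObj.one_counit, id_whiskerRight]⟩
  tensorLeft_reflectsIsomorphisms_of_strongEpi ε[H]

theorem reflectsIsomorphisms_of_strongEpi_evaluation {P A : C} [ExactPairing P A]
    [∀ X : C, StrongEpi (ε_ P A ▷ X)] : (tensorLeft A).ReflectsIsomorphisms :=
  have := tensorLeft_reflectsIsomorphisms_of_strongEpi (ε_ P A)
  have := tensorLeft_reflectsIsomorphisms_of_iso (β_ A P)
  tensorLeft_reflectsIsomorphisms_of_tensor P A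

theorem isFlat_of_exactPairing (P A : C) [ExactPairing P A] : IsFlat A :=
  let := swapPairing P A
  ⟨(tensorLeftAdjunction A P).rightAdjoint_preservesLimits.preservesLimitsOfShape⟩

section CofreeModule

open MonoidalClosed

variable [MonoidalClosed C] {H : C} [BimonObj H]

variable (H) in
/-- The action of `H` on `[H, Z]` given by `(h φ) k = φ (k h)`. -/
noncomputable def cofreeAct (Z : C) : H ⊗ (ihom H).obj Z ⟶ (ihom H).obj Z :=
  curry ((α_ H H _).inv ≫ μ[H] ▷ _ ≫ (ihom.ev H).app Z)

theorem whiskerLeft_cofreeAct_ev (Z : C) :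
    H ◁ cofreeAct H Z ≫ (ihom.ev H).app Z = (α_ H H _).inv ≫ μ[H] ▷ _ ≫ (ihom.ev H).app Z := by
  rw [← uncurry_eq, cofreeAct, uncurry_curry]

variable (H) in
/-- The cofree left `H`-module `[H, Z]` on an object `Z`. -/
@[reducible]
noncomputable def cofreeMod (Z : C) : Mod C H where
  X := (ihom H).obj Z
  mod :=
    { smul := cofreeAct H Z
      one_smul := uncurry_injective <| by
        change uncurry (η[H] ▷ _ ≫ cofreeAct H Z) = uncurry (λ_ _).hom
        rw [uncurry_eq, uncurry_eq, whiskerLeft_comp, Category.assoc, whiskerLeft_cofreeAct_ev,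
          associator_inv_naturality_middle_assoc, ← comp_whiskerRight_assoc, MonObj.mul_one]
        simp
      mul_smul := uncurry_injective <| by
        change uncurry (μ[H] ▷ _ ≫ cofreeAct H Z) =
          uncurry ((α_ H H _).hom ≫ H ◁ cofreeAct H Z ≫ cofreeAct H Z)
        simp only [uncurry_eq, whiskerLeft_comp, Category.assoc, whiskerLeft_cofreeAct_ev]
        rw [associator_inv_naturality_middle_assoc, ← comp_whiskerRight_assoc _ μ[H],
          MonObj.mul_assoc_flip, associator_inv_naturality_right_assoc, whisker_exchange_assoc,
          whiskerLeft_cofreeAct_ev]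
        monoidal }

theorem act_comp_curry (N : Mod C H) {Z : C} (k : N.X ⟶ Z) :
    act N ≫ curry (act N ≫ k) = H ◁ curry (act N ≫ k) ≫ act (cofreeMod H Z) := by
  apply uncurry_injective
  change _ = uncurry (_ ≫ cofreeAct H Z)
  simp only [uncurry_eq, whiskerLeft_comp, Category.assoc, whiskerLeft_cofreeAct_ev]
  rw [associator_inv_naturality_right_assoc, whisker_exchange_assoc, ← uncurry_eq, uncurry_curry,
    reassoc_of% mul_act N, Iso.inv_hom_id_assoc]

theorem unit_whiskerRight_uncurry_act {N : Mod C H} {Z : C} (s : N ⟶ cofreeMod H Z) :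
    act N ≫ (λ_ N.X).inv ≫ η[H] ▷ N.X ≫ uncurry s.hom = uncurry s.hom := by
  have hs : H ◁ act N ≫ uncurry s.hom = (α_ H H _).inv ≫ μ[H] ▷ _ ≫ uncurry s.hom := by
    rw [uncurry_eq, ← whiskerLeft_comp_assoc, act_hom s]
    change H ◁ (_ ≫ cofreeAct H Z) ≫ _ = _
    rw [whiskerLeft_comp, Category.assoc, whiskerLeft_cofreeAct_ev,
      associator_inv_naturality_right_assoc, whisker_exchange_assoc]
  rw [leftUnitor_inv_naturality_assoc, whisker_exchange_assoc, hs,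
    associator_inv_naturality_left_assoc, ← comp_whiskerRight_assoc, MonObj.one_mul]
  simp

variable (H) in
/-- Morphisms to the cofree module are the same as morphisms in the underlying category. -/
noncomputable def cofreeModHomEquiv (N : Mod C H) (Z : C) :
    (N.X ⟶ Z) ≃ (N ⟶ cofreeMod H Z) where
  toFun k := mkHom (curry (act N ≫ k)) (act_comp_curry N k)
  invFun s := (λ_ N.X).inv ≫ η[H] ▷ N.X ≫ uncurry s.hom
  left_inv k := by
    change (λ_ N.X).inv ≫ η[H] ▷ N.X ≫ uncurry (curry (act N ≫ k)) = k
    rw [uncurry_curry, reassoc_of% one_act N, Iso.inv_hom_id_assoc]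
  right_inv s := by
    ext
    change curry (act N ≫ (λ_ N.X).inv ≫ η[H] ▷ N.X ≫ uncurry s.hom) = s.hom
    rw [unit_whiskerRight_uncurry_act, curry_uncurry]

theorem cofreeModHomEquiv_naturality_left {M N : Mod C H} {Z : C} (f : M ⟶ N) (k : N.X ⟶ Z) :
    cofreeModHomEquiv H M Z (f.hom ≫ k) = f ≫ cofreeModHomEquiv H N Z k := by
  ext
  change curry (act M ≫ f.hom ≫ k) = f.hom ≫ curry (act N ≫ k)
  rw [← Category.assoc, act_hom, Category.assoc, curry_natural_left]

instance forget_isLeftAdjoint : (Mod.forget H : Mod C H ⥤ C).IsLeftAdjoint :=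
  (Adjunction.adjunctionOfEquivRight (F := Mod.forget H) (cofreeModHomEquiv H)
    fun _ _ _ => cofreeModHomEquiv_naturality_left).isLeftAdjoint

theorem strongEpi_whiskerRight_of_isColimit {M N Q : Mod C H} {f g : M ⟶ N} {π : N ⟶ Q}
    {w : f ≫ π = g ≫ π} (hπ : IsColimit (Cofork.ofπ π w)) (X : C) : StrongEpi (π.hom ▷ X) :=
  let F : Mod C H ⥤ C := Mod.forget H ⋙ tensorRight X
  have : IsRegularEpi (F.map π) := ⟨⟨{
    W := F.obj M
    left := F.map f
    right := F.map g
    w := by rw [← F.map_comp, w, F.map_comp]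
    isColimit := isColimitCoforkMapOfIsColimit F w hπ }⟩⟩
  inferInstanceAs (StrongEpi (F.map π))

end CofreeModule

/-- The algebra `A` has a dual for which the first of the two canonical morphisms in the
definition of an Azumaya algebra is an isomorphism, and tensoring with `A` reflects
isomorphisms. -/
structure IsLeftAzumaya (A : C) [MonObj A] : Prop where
  reflectsIsomorphisms : (tensorLeft A).ReflectsIsomorphisms
  exists_isIso : ∃ (P : C) (_ : ExactPairing P A), IsIso (azumayaLeft A P)

theorem IsLeftAzumaya.isFinite {A : C} [MonObj A] (hA : IsLeftAzumaya A) : IsFinite A :=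
  let ⟨P, p, _⟩ := hA.exists_isIso
  ⟨P, ⟨p⟩⟩

theorem IsLeftAzumaya.isFlat {A : C} [MonObj A] (hA : IsLeftAzumaya A) : IsFlat A :=
  have ⟨P, _, _⟩ := hA.exists_isIso
  isFlat_of_exactPairing P A

/-- The exact pairing in `C` underlying an exact pairing of `H`-modules. -/
@[reducible]
def underlyingPairing {H : C} [BimonObj H] (P A : Mod C H) [ExactPairing P A] :
    ExactPairing P.X A.X where
  coevaluation' := (η_ P A).hom
  evaluation' := (ε_ P A).hom
  coevaluation_evaluation' := congrArg Mod.Hom.hom (ExactPairing.coevaluation_evaluation P A)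
  evaluation_coevaluation' := congrArg Mod.Hom.hom (ExactPairing.evaluation_coevaluation P A)

theorem IsAzumayaAlg.isLeftAzumaya [MonoidalClosed C] {H : C} [BimonObj H] [HLinearBraiding H]
    {A : Mod C H} [MonObj A] (hA : IsAzumayaAlg A) : IsLeftAzumaya A.X := by
  obtain ⟨P, p, ⟨hε⟩, hl, -⟩ := hA
  let := underlyingPairing P A
  have (X : C) : StrongEpi (ε_ P.X A.X ▷ X) := strongEpi_whiskerRight_of_isColimit hε X
  refine ⟨reflectsIsomorphisms_of_strongEpi_evaluation (P := P.X), P.X, inferInstance, ?_⟩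
  exact inferInstanceAs (IsIso ((Mod.forget H).map (azumayaLeft A P)))

/-! ### Galois objects in a smash product -/

section Galois

theorem can_eq_linearExt {H : C} [BimonObj H] (T : ComodAlg H) : T.can = linearExt T.coact := rfl

theorem comul_linearExt_comul {H S : C} [BimonObj H] [MonObj S] {κ θ : H ⟶ S}
    (h : Δ[H] ≫ (κ ⊗ₘ θ) ≫ μ[S] = ε[H] ≫ η[S]) :
    (Δ[H] ≫ κ ▷ H) ≫ linearExt (Δ[H] ≫ θ ▷ H) = (λ_ H).inv ≫ η[S] ▷ H := by
  calc (Δ[H] ≫ κ ▷ H) ≫ linearExt (Δ[H] ≫ θ ▷ H)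
    _ = Δ[H] ≫ H ◁ Δ[H] ≫ (α_ H H H).inv ≫ ((κ ⊗ₘ θ) ≫ μ[S]) ▷ H := by
      simp only [linearExt, Category.assoc, whiskerLeft_comp, comp_whiskerRight,
        MonoidalCategory.tensorHom_def]
      rw [← whisker_exchange_assoc]
      monoidal
    _ = Δ[H] ≫ (Δ[H] ≫ (κ ⊗ₘ θ) ≫ μ[S]) ▷ H := by
      simp
    _ = _ := by
      rw [h, comp_whiskerRight, ComonObj.counit_comul_assoc]

theorem isIso_linearExt_comul {H S : C} [HopfObj H] [MonObj S] (κ : H ⟶ S) [IsMonHom κ] :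
    IsIso (linearExt (Δ[H] ≫ κ ▷ H)) := by
  refine isIso_linearExt (g := Δ[H] ≫ (HopfObj.antipode (X := H) ≫ κ) ▷ H)
    (comul_linearExt_comul ?_) (comul_linearExt_comul ?_)
  · have e : (κ ⊗ₘ HopfObj.antipode (X := H) ≫ κ) = H ◁ HopfObj.antipode ≫ (κ ⊗ₘ κ) := by
      rw [← id_tensorHom, tensorHom_comp_tensorHom, Category.id_comp]
    rw [e, Category.assoc, ← IsMonHom.mul_hom, HopfObj.antipode_right_assoc, IsMonHom.one_hom]
  · have e : (HopfObj.antipode (X := H) ≫ κ ⊗ₘ κ) = HopfObj.antipode ▷ H ≫ (κ ⊗ₘ κ) := by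
      rw [← tensorHom_id, tensorHom_comp_tensorHom, Category.id_comp]
    rw [e, Category.assoc, ← IsMonHom.mul_hom, HopfObj.antipode_left_assoc, IsMonHom.one_hom]

theorem whiskerLeft_linearExt {A S T X Y : C} [MonObj S] [MonObj T] (i : A ⟶ S) (j : T ⟶ S)
    [IsMonHom j] (f : X ⟶ T ⊗ Y) :
    A ◁ linearExt f ≫ (α_ A T Y).inv ≫ (A ◁ j ≫ leftMul i) ▷ Y =
      (α_ A T X).inv ≫ (A ◁ j ≫ leftMul i) ▷ X ≫ linearExt (f ≫ j ▷ Y) := by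
  have h : A ◁ μ[T] ≫ A ◁ j ≫ leftMul i =
      (α_ A T T).inv ≫ (A ◁ j ≫ leftMul i) ▷ T ≫ S ◁ j ≫ μ[S] := by
    rw [← whiskerLeft_comp_assoc, IsMonHom.mul_hom, whiskerLeft_comp, Category.assoc,
      mul_leftMul, MonoidalCategory.tensorHom_def, comp_whiskerRight, Category.assoc,
      ← whisker_exchange_assoc]
    simp
  generalize A ◁ j ≫ leftMul i = t at *
  replace h := congrArg (· ▷ Y) h
  simp only [comp_whiskerRight] at h
  simp only [linearExt, whiskerLeft_comp, Category.assoc]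
  rw [associator_inv_naturality_middle_assoc, h, ← whisker_exchange_assoc]
  monoidal

theorem whiskerRight_linearExt_comul {H : C} [BimonObj H] [HLinearBraiding H] {S : ComodAlg H}
    {A : C} {i : A ⟶ S.X} (hi : i ≫ S.coact = (ρ_ A).inv ≫ (i ⊗ₘ η[H])) {κ : H ⟶ S.X}
    (hκ : κ ≫ S.coact = Δ[H] ≫ κ ▷ H) :
    i ▷ H ≫ linearExt (Δ[H] ≫ κ ▷ H) = (A ◁ κ ≫ leftMul i) ≫ S.coact := by
  rw [Category.assoc, leftMul_coact S i hi, ← whiskerLeft_comp_assoc, hκ, linearExt,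
    ← whisker_exchange_assoc]
  simp [leftMul]

theorem isIso_can_of_bases {H : C} [HopfObj H] [HLinearBraiding H] {S T : ComodAlg H} {A : C}
    [MonObj A] [(tensorLeft A).ReflectsIsomorphisms] (i : A ⟶ S.X) [IsMonHom i]
    (hi : i ≫ S.coact = (ρ_ A).inv ≫ (i ⊗ₘ η[H])) (j : T ⟶ S)
    [IsIso (A ◁ j.hom ≫ leftMul i)] (κ : H ⟶ S.X) [IsMonHom κ]
    (hκ : κ ≫ S.coact = Δ[H] ≫ κ ▷ H) [IsIso (A ◁ κ ≫ leftMul i)] : IsIso T.can := by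
  have change_basis : linearExt (coords i j.hom κ ≫ i ▷ H) ≫ linearExt (Δ[H] ≫ κ ▷ H) =
      linearExt (j.hom ≫ S.coact) := by
    rw [linearExt_comp, Category.assoc, whiskerRight_linearExt_comul hi hκ, coords,
      Category.assoc, IsIso.inv_hom_id_assoc]
  have : IsIso (linearExt (j.hom ≫ S.coact)) := by
    have := isIso_linearExt_coords i j.hom κ
    have := isIso_linearExt_comul κ
    exact change_basis ▸ inferInstance
  have : IsIso (A ◁ T.can ≫ (α_ A T.X H).inv ≫ (A ◁ j.hom ≫ leftMul i) ▷ H) := by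
    rw [can_eq_linearExt, whiskerLeft_linearExt i j.hom T.coact, j.colinear]
    infer_instance
  have : IsIso (A ◁ T.can) :=
    IsIso.of_isIso_comp_right _ ((α_ A T.X H).inv ≫ (A ◁ j.hom ≫ leftMul i) ▷ H)
  exact isIso_of_whiskerLeft A T.can

end Galois

section Smash

variable {H : C} [BimonObj H] (A : Mod C H) [MonObj A]

theorem leftMul_smashIncl : leftMul (smashIncl A) = smashLeft A := by
  change ((ρ_ A.X).inv ≫ A.X ◁ η[H]) ▷ (A.X ⊗ H) ≫ smashMul A = smashLeft A
  rw [smashMul, comp_whiskerRight, Category.assoc, associator_naturality_middle_assoc,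
    ← whiskerLeft_comp_assoc, smashAct_one]
  monoidal

instance isMonHom_smashIncl : IsMonHom (smashIncl A) :=
  isMonHom_of_leftMul
    (by
      change η[A.X] ≫ (ρ_ A.X).inv ≫ A.X ◁ η[H] = smashOne A
      simp [smashOne, MonoidalCategory.tensorHom_def, unitors_inv_equal])
    (by
      rw [leftMul_smashIncl]
      change A.X ◁ ((ρ_ A.X).inv ≫ A.X ◁ η[H]) ≫ (α_ A.X A.X H).inv ≫ μ[A.X] ▷ H =
        μ[A.X] ≫ (ρ_ A.X).inv ≫ A.X ◁ η[H]
      rw [whiskerLeft_comp, Category.assoc, associator_inv_naturality_right_assoc,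
        whisker_exchange]
      monoidal)

/-- The embedding `h ↦ 1 # h` of `H` into the smash product `A # H`. -/
def smashInclH : H ⟶ (smash A).X := (λ_ H).inv ≫ η[A.X] ▷ H

theorem leftMul_smashInclH : leftMul (smashInclH A) = smashAct A := by
  change ((λ_ H).inv ≫ η[A.X] ▷ H) ▷ (A.X ⊗ H) ≫ smashMul A = smashAct A
  rw [smashMul, comp_whiskerRight, Category.assoc, associator_naturality_left_assoc,
    ← whisker_exchange_assoc, smashLeft, associator_inv_naturality_left_assoc,
    ← comp_whiskerRight, MonObj.one_mul]
  monoidal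

instance isMonHom_smashInclH : IsMonHom (smashInclH A) :=
  isMonHom_of_leftMul
    (by
      change η[H] ≫ (λ_ H).inv ≫ η[A.X] ▷ H = smashOne A
      simp [smashOne, MonoidalCategory.tensorHom_def'])
    (by
      rw [leftMul_smashInclH]
      exact smashAct_unit A)

theorem smashInclH_coact : smashInclH A ≫ (smash A).coact = Δ[H] ≫ smashInclH A ▷ H := by
  change ((λ_ H).inv ≫ η[A.X] ▷ H) ≫ A.X ◁ Δ[H] ≫ (α_ A.X H H).inv =
    Δ[H] ≫ ((λ_ H).inv ≫ η[A.X] ▷ H) ▷ H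
  rw [Category.assoc, ← whisker_exchange_assoc]
  monoidal

theorem whiskerLeft_smashInclH_leftMul :
    A.X ◁ smashInclH A ≫ leftMul (smashIncl A) = 𝟙 (A.X ⊗ H) := by
  rw [leftMul_smashIncl]
  change A.X ◁ ((λ_ H).inv ≫ η[A.X] ▷ H) ≫ (α_ A.X A.X H).inv ≫ μ[A.X] ▷ H = 𝟙 (A.X ⊗ H)
  rw [whiskerLeft_comp, Category.assoc, associator_inv_naturality_middle_assoc,
    ← comp_whiskerRight, MonObj.mul_one]
  simp

theorem isGaloisObj_of_smash [HasEqualizers C] {H : C} [HopfObj H] [HLinearBraiding H] [IsFlat H]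
    (A : Mod C H) [MonObj A] [IsFlat A.X] [(tensorLeft A.X).ReflectsIsomorphisms] {T : ComodAlg H}
    (j : T ⟶ smash A) [IsIso (A.X ◁ j.hom ≫ leftMul (smashIncl A))] : IsGaloisObj T where
  faithfullyFlat :=
    have e : A.X ⊗ T.X ≅ (smash A).X := asIso (A.X ◁ j.hom ≫ leftMul (smashIncl A))
    isFaithfullyFlat_of_iso (Y := H) e
  isIso_can :=
    have : IsIso (A.X ◁ smashInclH A ≫ leftMul (smashIncl A)) := by
      rw [whiskerLeft_smashInclH_leftMul]
      exact inferInstanceAs (IsIso (𝟙 (A.X ⊗ H)))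
    isIso_can_of_bases (smashIncl A) (smashIncl_coact A) j (smashInclH A) (smashInclH_coact A)

end Smash

/-! ### The smash product with a tensor product of module algebras -/

section TensorInterchange

variable (A B X Y : C)

theorem tensorμ_natural_third {X X' : C} (f : X ⟶ X') :
    (A ⊗ B) ◁ f ▷ Y ≫ tensorμ A B X' Y = tensorμ A B X Y ≫ (A ◁ f) ▷ (B ⊗ Y) := by
  simpa using tensorμ_natural_right A B f (𝟙 Y)

theorem tensorμ_natural_fourth {Y Y' : C} (f : Y ⟶ Y') :
    (A ⊗ B) ◁ X ◁ f ≫ tensorμ A B X Y' = tensorμ A B X Y ≫ (A ⊗ X) ◁ B ◁ f := by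
  simpa using tensorμ_natural_right A B (𝟙 X) f

instance isIso_tensorμ : IsIso (tensorμ A B X Y) :=
  ⟨tensorδ A B X Y, tensorμ_tensorδ A B X Y, tensorδ_tensorμ A B X Y⟩

end TensorInterchange

section ComulSplit

variable {H : C} [BimonObj H]

/-- The morphism `a ⊗ b ⊗ h ↦ (a ⊗ h₁) ⊗ (b ⊗ h₂)`, which underlies the morphism
`(a ⊗ b) # h ↦ (a # h₁) ⊗ (b # h₂)` of smash products. -/
def comulSplit (H : C) [BimonObj H] (A B : C) : (A ⊗ B) ⊗ H ⟶ (A ⊗ H) ⊗ (B ⊗ H) :=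
  (A ⊗ B) ◁ Δ[H] ≫ tensorμ A B H H

/-- The retraction `(a ⊗ h) ⊗ (b ⊗ k) ↦ ε(h) a ⊗ b ⊗ k` of `comulSplit`. -/
def counitMerge (H : C) [BimonObj H] (A B : C) : (A ⊗ H) ⊗ (B ⊗ H) ⟶ (A ⊗ B) ⊗ H :=
  (A ◁ ε[H] ≫ (ρ_ A).hom) ▷ (B ⊗ H) ≫ (α_ A B H).inv

theorem comulSplit_one {A B : C} (a : 𝟙_ C ⟶ A) (b : 𝟙_ C ⟶ B) :
    ((λ_ (𝟙_ C)).inv ≫ (((λ_ (𝟙_ C)).inv ≫ (a ⊗ₘ b)) ⊗ₘ η[H])) ≫ comulSplit H A B =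
      (λ_ (𝟙_ C)).inv ≫ (((λ_ (𝟙_ C)).inv ≫ (a ⊗ₘ η[H])) ⊗ₘ ((λ_ (𝟙_ C)).inv ≫ (b ⊗ₘ η[H]))) := by
  have one_comul : η[H] ≫ Δ[H] = (λ_ (𝟙_ C)).inv ≫ (η[H] ⊗ₘ η[H]) := BimonObj.one_comul H
  have unit_comul : (((λ_ (𝟙_ C)).inv ≫ (a ⊗ₘ b)) ⊗ₘ η[H]) ≫ (A ⊗ B) ◁ Δ[H] =
      ((λ_ (𝟙_ C)).inv ⊗ₘ (λ_ (𝟙_ C)).inv) ≫ ((a ⊗ₘ b) ⊗ₘ (η[H] ⊗ₘ η[H])) := by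
    rw [← id_tensorHom, tensorHom_comp_tensorHom, Category.comp_id, one_comul,
      tensorHom_comp_tensorHom]
  have tensorμ_unit : tensorμ (𝟙_ C) (𝟙_ C) (𝟙_ C) (𝟙_ C) = 𝟙 _ := by
    simp only [tensorμ, braiding_tensorUnit_left]
    monoidal
  rw [comulSplit, Category.assoc, reassoc_of% unit_comul, tensorμ_natural, tensorμ_unit,
    Category.id_comp, tensorHom_comp_tensorHom]

theorem comulSplit_whiskerRight_tensorμ {A B S T : C} (a : H ⊗ S ⟶ S) (b : H ⊗ T ⟶ T)
    (l : A ⊗ S ⟶ S) (m : B ⊗ T ⟶ T) :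
    comulSplit H A B ▷ (S ⊗ T) ≫ tensorμ (A ⊗ H) (B ⊗ H) S T ≫
        ((α_ A H S).hom ≫ A ◁ a ≫ l ⊗ₘ (α_ B H T).hom ≫ B ◁ b ≫ m) =
      (α_ (A ⊗ B) H (S ⊗ T)).hom ≫ (A ⊗ B) ◁ diagAct a b ≫ tensorμ A B S T ≫ (l ⊗ₘ m) := by
  have assoc := tensor_associativity A B H H S T
  simp only [← tensorHom_comp_tensorHom]
  rw [comulSplit, comp_whiskerRight, Category.assoc, reassoc_of% assoc,
    ← tensorμ_natural_right_assoc, associator_naturality_middle_assoc, diagAct]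
  simp only [whiskerLeft_comp, Category.assoc]

theorem comp_eq_comulSplit_tensorHom {A B S T U : C} {a : H ⊗ S ⟶ S} {b : H ⊗ T ⟶ T}
    {c : H ⊗ U ⟶ U} {l : A ⊗ S ⟶ S} {m : B ⊗ T ⟶ T} {n : (A ⊗ B) ⊗ U ⟶ U} {σ : U ⟶ S ⊗ T}
    (act : c ≫ σ = H ◁ σ ≫ diagAct a b)
    (left : n ≫ σ = (A ⊗ B) ◁ σ ≫ tensorμ A B S T ≫ (l ⊗ₘ m)) :
    ((α_ (A ⊗ B) H U).hom ≫ (A ⊗ B) ◁ c ≫ n) ≫ σ =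
      (comulSplit H A B ⊗ₘ σ) ≫ tensorμ (A ⊗ H) (B ⊗ H) S T ≫
        ((α_ A H S).hom ≫ A ◁ a ≫ l ⊗ₘ (α_ B H T).hom ≫ B ◁ b ≫ m) := by
  simp only [MonoidalCategory.tensorHom_def' (comulSplit H A B), Category.assoc]
  rw [comulSplit_whiskerRight_tensorμ, associator_naturality_right_assoc,
    ← whiskerLeft_comp_assoc, ← act, whiskerLeft_comp, Category.assoc, left]

variable (A B : C)

theorem comulSplit_coact :
    ((A ⊗ B) ◁ Δ[H] ≫ (α_ (A ⊗ B) H H).inv) ≫ comulSplit H A B ▷ H =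
      comulSplit H A B ≫ (A ⊗ H) ◁ (B ◁ Δ[H] ≫ (α_ B H H).inv) ≫ (α_ (A ⊗ H) (B ⊗ H) H).inv := by
  have coassoc := congrArg (fun t => (A ⊗ B) ◁ t) (ComonObj.comul_assoc H)
  simp only [whiskerLeft_comp] at coassoc
  simp only [comulSplit, comp_whiskerRight, Category.assoc, whiskerLeft_comp]
  rw [← reassoc_of% tensorμ_natural_fourth, reassoc_of% coassoc,
    ← associator_inv_naturality_middle_assoc]
  simp only [tensorμ]
  monoidal

theorem rightUnitor_comulSplit :
    ((ρ_ (A ⊗ B)).inv ≫ (A ⊗ B) ◁ η[H]) ≫ comulSplit H A B =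
      ((ρ_ A).inv ≫ A ◁ η[H] ⊗ₘ (ρ_ B).inv ≫ B ◁ η[H]) := by
  have one_comul : η[H] ≫ Δ[H] = (λ_ (𝟙_ C)).inv ≫ (η[H] ⊗ₘ η[H]) := BimonObj.one_comul H
  have tensorμ_unit : (ρ_ (A ⊗ B)).inv ≫ (A ⊗ B) ◁ (λ_ (𝟙_ C)).inv ≫ tensorμ A B (𝟙_ C) (𝟙_ C) =
      ((ρ_ A).inv ⊗ₘ (ρ_ B).inv) := by
    simp only [tensorμ, braiding_tensorUnit_right]
    monoidal
  rw [comulSplit, Category.assoc, ← whiskerLeft_comp_assoc, one_comul, whiskerLeft_comp,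
    Category.assoc, tensorμ_natural_right, reassoc_of% tensorμ_unit, tensorHom_comp_tensorHom]

theorem comulSplit_counitMerge : comulSplit H A B ≫ counitMerge H A B = 𝟙 _ := by
  simp only [comulSplit, counitMerge, comp_whiskerRight, Category.assoc]
  rw [← reassoc_of% tensorμ_natural_third, ← whiskerLeft_comp_assoc, ComonObj.counit_comul]
  simp only [tensorμ, braiding_tensorUnit_right]
  monoidal

variable [HLinearBraiding H]

theorem whiskerLeft_leftCoact_comul :
    A ◁ ((B ◁ Δ[H] ≫ (α_ B H H).inv) ≫ (β_ (B ⊗ H) H).hom) ≫ (α_ A H (B ⊗ H)).inv =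
      (α_ A B H).inv ≫ comulSplit H A B := by
  have hc := congrArg (fun t => (A ⊗ B) ◁ t) (cocomm (H := H))
  simp only [whiskerLeft_comp] at hc
  rw [BraidedCategory.braiding_tensor_left_hom, comulSplit, ← hc]
  simp only [tensorμ]
  monoidal

theorem comulSplit_condition :
    comulSplit H A B ≫ (A ⊗ H) ◁ ((B ◁ Δ[H] ≫ (α_ B H H).inv) ≫ (β_ (B ⊗ H) H).hom) ≫
        (α_ (A ⊗ H) H (B ⊗ H)).inv =
      comulSplit H A B ≫ (A ◁ Δ[H] ≫ (α_ A H H).inv) ▷ (B ⊗ H) := by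
  have coassoc := congrArg (fun t => (A ⊗ B) ◁ t) (ComonObj.comul_assoc H)
  simp only [whiskerLeft_comp] at coassoc
  rw [whiskerLeft_leftCoact_comul]
  simp only [comulSplit, comp_whiskerRight, Category.assoc]
  rw [← reassoc_of% tensorμ_natural_third, ← associator_inv_naturality_right_assoc,
    ← reassoc_of% tensorμ_natural_fourth, reassoc_of% coassoc]
  simp only [tensorμ, BraidedCategory.braiding_tensor_right_hom]
  monoidal

/-- The morphism `comulSplit` exhibits `A ⊗ B ⊗ H` as the cotensor product of the cofree comodules
`A ⊗ H` and `B ⊗ H`; the counit splits the equalizer. -/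
def comulSplitIsSplitEqualizer :
    IsSplitEqualizer
      ((A ⊗ H) ◁ ((B ◁ Δ[H] ≫ (α_ B H H).inv) ≫ (β_ (B ⊗ H) H).hom) ≫
        (α_ (A ⊗ H) H (B ⊗ H)).inv)
      ((A ◁ Δ[H] ≫ (α_ A H H).inv) ▷ (B ⊗ H)) (comulSplit H A B) where
  leftRetraction := counitMerge H A B
  rightRetraction := (A ◁ ε[H] ≫ (ρ_ A).hom) ▷ H ▷ (B ⊗ H)
  condition := comulSplit_condition A B
  ι_leftRetraction := comulSplit_counitMerge A B
  bottom_rightRetraction := by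
    have counit : (A ◁ Δ[H] ≫ (α_ A H H).inv) ≫ (A ◁ ε[H] ≫ (ρ_ A).hom) ▷ H = 𝟙 _ := by
      rw [comp_whiskerRight, Category.assoc, ← associator_inv_naturality_middle_assoc,
        ← whiskerLeft_comp_assoc, ComonObj.counit_comul]
      monoidal
    rw [← comp_whiskerRight, counit, id_whiskerRight]
  top_rightRetraction := by
    rw [counitMerge, Category.assoc _ (α_ A B H).inv, ← whiskerLeft_leftCoact_comul,
      Category.assoc ((A ⊗ H) ◁ _), ← associator_inv_naturality_left, whisker_exchange_assoc]

end ComulSplit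

section SmashSplit

variable {H : C} [BimonObj H] [HLinearBraiding H] (A B : Mod C H)

theorem smashAct_comulSplit : smashAct (A ⊗ B) ≫ comulSplit H A.X B.X =
    H ◁ comulSplit H A.X B.X ≫ diagAct (smashAct A) (smashAct B) :=
  act_hom ((A ⊗ B) ◁ comulHom ≫ tensorμ A B (Mod.regular H) (Mod.regular H))

variable [MonObj A] [MonObj B]

theorem smashLeft_comulSplit :
    smashLeft (A ⊗ B) ≫ comulSplit H A.X B.X = (A.X ⊗ B.X) ◁ comulSplit H A.X B.X ≫
      tensorμ A.X B.X (A.X ⊗ H) (B.X ⊗ H) ≫ (smashLeft A ⊗ₘ smashLeft B) := by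
  have assoc := congrArg (fun t => (α_ (A.X ⊗ B.X) (A.X ⊗ B.X) (H ⊗ H)).inv ≫ t ≫
    ((α_ A.X A.X H).inv ⊗ₘ (α_ B.X B.X H).inv)) (tensor_associativity A.X B.X A.X B.X H H)
  simp only [Category.assoc, Iso.inv_hom_id_assoc, tensorHom_comp_tensorHom, Iso.hom_inv_id,
    id_tensorHom_id, Category.comp_id] at assoc
  have smashLeft_tensor : (smashLeft A ⊗ₘ smashLeft B) =
      ((α_ A.X A.X H).inv ⊗ₘ (α_ B.X B.X H).inv) ≫ (μ[A.X] ▷ H ⊗ₘ μ[B.X] ▷ H) := by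
    simp only [smashLeft, tensorHom_comp_tensorHom]
  change ((α_ (A.X ⊗ B.X) (A.X ⊗ B.X) H).inv ≫
    (tensorμ A.X B.X A.X B.X ≫ (μ[A.X] ⊗ₘ μ[B.X])) ▷ H) ≫ (A.X ⊗ B.X) ◁ Δ[H] ≫
      tensorμ A.X B.X H H = (A.X ⊗ B.X) ◁ ((A.X ⊗ B.X) ◁ Δ[H] ≫ tensorμ A.X B.X H H) ≫ _
  rw [smashLeft_tensor, Category.assoc, ← whisker_exchange_assoc, comp_whiskerRight,
    Category.assoc, tensorμ_natural_left, ← associator_inv_naturality_right_assoc,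
    whiskerLeft_comp, Category.assoc, ← reassoc_of% assoc]

theorem smashMul_comulSplit : smashMul (A ⊗ B) ≫ comulSplit H A.X B.X =
    (comulSplit H A.X B.X ⊗ₘ comulSplit H A.X B.X) ≫
      tensorμ (A.X ⊗ H) (B.X ⊗ H) (A.X ⊗ H) (B.X ⊗ H) ≫ (smashMul A ⊗ₘ smashMul B) :=
  comp_eq_comulSplit_tensorHom (smashAct_comulSplit A B) (smashLeft_comulSplit A B)

/-- The morphism of comodule algebras `(a ⊗ b) # h ↦ (a # h₁) ⊗ (b # h₂)`. -/
def smashSplitHom : smash (A ⊗ B) ⟶ tensorComodAlg (smash A) (smash B) where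
  hom := comulSplit H A.X B.X
  isMonHom :=
    { one_hom := comulSplit_one η[A.X] η[B.X]
      mul_hom := smashMul_comulSplit A B }
  colinear := comulSplit_coact A.X B.X

theorem smashIncl_smashSplitHom :
    smashIncl (A ⊗ B) ≫ (smashSplitHom A B).hom = (smashIncl A ⊗ₘ smashIncl B) :=
  rightUnitor_comulSplit A.X B.X

end SmashSplit

/-! ### Cotensor products -/

section SubComodAlg

variable [HasEqualizers C] {H : C} [BimonObj H] [IsFlat H]

/-- The inclusion of an equalizer as a comodule subalgebra. -/
noncomputable def subComodAlgHom (M : ComodAlg H) {N : C} (f g : M.X ⟶ N)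
    (h₁ : η[M.X] ≫ f = η[M.X] ≫ g)
    (h₂ : (equalizer.ι f g ⊗ₘ equalizer.ι f g) ≫ μ[M.X] ≫ f =
      (equalizer.ι f g ⊗ₘ equalizer.ι f g) ≫ μ[M.X] ≫ g)
    (h₃ : equalizer.ι f g ≫ M.coact ≫ f ▷ H = equalizer.ι f g ≫ M.coact ≫ g ▷ H) :
    subComodAlg M f g h₁ h₂ h₃ ⟶ M where
  hom := equalizer.ι f g
  isMonHom :=
    { one_hom := equalizer.lift_ι _ _
      mul_hom := equalizer.lift_ι _ _ }
  colinear := Fork.IsLimit.lift_ι' (equalizerTensor f g) _ _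

end SubComodAlg

section Balanced

variable {H : C} [BimonObj H]

/-- A morphism into `S ⊗ T` is balanced if it equalizes the two morphisms to `S ⊗ H ⊗ T` whose
equalizer is the cotensor product. -/
def IsBalanced (S T : ComodAlg H) {X : C} (x : X ⟶ S.X ⊗ T.X) : Prop :=
  x ≫ S.coact ▷ T.X = x ≫ S.X ◁ leftCoact T ≫ (α_ S.X H T.X).inv

theorem IsBalanced.precomp {S T : ComodAlg H} {X Y : C} {x : X ⟶ S.X ⊗ T.X}
    (hx : IsBalanced S T x) (f : Y ⟶ X) : IsBalanced S T (f ≫ x) := by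
  rw [IsBalanced, Category.assoc, Category.assoc, hx]

section Functoriality

variable {S S' T T' : ComodAlg H} (f : S ⟶ T) (g : S' ⟶ T')

/-- The tensor product of two morphisms of comodule algebras. -/
@[reducible]
def tensorComodAlgHom : tensorComodAlg S S' ⟶ tensorComodAlg T T' where
  hom := f.hom ⊗ₘ g.hom
  colinear := by
    have colinear : S'.coact ≫ g.hom ▷ H = g.hom ≫ T'.coact := g.colinear
    simp only [MonoidalCategory.tensorHom_def, Category.assoc, comp_whiskerRight]
    rw [← whiskerLeft_comp_assoc, ← colinear, whiskerLeft_comp, Category.assoc,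
      ← whisker_exchange_assoc]
    monoidal

theorem leftCoact_naturality : g.hom ≫ leftCoact T' = leftCoact S' ≫ H ◁ g.hom := by
  rw [leftCoact, leftCoact, Category.assoc, ← BraidedCategory.braiding_naturality_left,
    reassoc_of% g.colinear]

theorem tensorHom_coact :
    (f.hom ⊗ₘ g.hom) ≫ T.coact ▷ T'.X = S.coact ▷ S'.X ≫ (f.hom ▷ H ⊗ₘ g.hom) := by
  rw [← tensorHom_id, ← tensorHom_id, tensorHom_comp_tensorHom, tensorHom_comp_tensorHom,
    f.colinear, Category.comp_id, Category.id_comp]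

theorem tensorHom_leftCoact :
    (f.hom ⊗ₘ g.hom) ≫ T.X ◁ leftCoact T' ≫ (α_ T.X H T'.X).inv =
      (S.X ◁ leftCoact S' ≫ (α_ S.X H S'.X).inv) ≫ (f.hom ▷ H ⊗ₘ g.hom) := by
  rw [← id_tensorHom T.X, tensorHom_comp_tensorHom_assoc, Category.comp_id,
    leftCoact_naturality, ← tensorHom_id, Category.assoc, ← associator_inv_naturality,
    ← id_tensorHom S.X, tensorHom_comp_tensorHom_assoc, Category.id_comp, id_tensorHom]

theorem isBalanced_tensorHom_iff [Mono (f.hom ▷ H ⊗ₘ g.hom)] {X : C} (x : X ⟶ S.X ⊗ S'.X) :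
    IsBalanced T T' (x ≫ (f.hom ⊗ₘ g.hom)) ↔ IsBalanced S S' x := by
  rw [IsBalanced, IsBalanced, Category.assoc, Category.assoc, tensorHom_coact,
    tensorHom_leftCoact, ← Category.assoc, ← Category.assoc, cancel_mono]

end Functoriality

variable [HLinearBraiding H] [HasEqualizers C] [IsFlat H] (S T : ComodAlg H)

/-- The inclusion of the cotensor product into the tensor product. -/
noncomputable def cotensorHom : cotensor S T ⟶ tensorComodAlg S T :=
  subComodAlgHom (tensorComodAlg S T) (S.coact ▷ T.X)
    (S.X ◁ leftCoact T ≫ (α_ S.X H T.X).inv) _ _ _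

theorem isBalanced_cotensorHom : IsBalanced S T (cotensorHom S T).hom :=
  equalizer.condition _ _

/-- The equalizer that defines the cotensor product. -/
noncomputable def cotensorHomIsEqualizer :
    IsLimit (Fork.ofι (cotensorHom S T).hom (isBalanced_cotensorHom S T)) :=
  equalizerIsEqualizer _ _

instance mono_cotensorHom : Mono (cotensorHom S T).hom :=
  inferInstanceAs (Mono (equalizer.ι _ _))

theorem IsBalanced.exists_lift_cotensorHom {S T : ComodAlg H} {X : C} {x : X ⟶ S.X ⊗ T.X}
    (hx : IsBalanced S T x) : ∃ y, y ≫ (cotensorHom S T).hom = x :=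
  ⟨equalizer.lift x hx, equalizer.lift_ι _ _⟩

end Balanced

section SmashSplit

variable {H : C} [BimonObj H] [HLinearBraiding H] (A B : Mod C H) [MonObj A] [MonObj B]

theorem isBalanced_smashSplitHom : IsBalanced (smash A) (smash B) (smashSplitHom A B).hom :=
  (comulSplit_condition A.X B.X).symm

theorem IsBalanced.exists_lift_smashSplitHom {A B : Mod C H} [MonObj A] [MonObj B] {X : C}
    {x : X ⟶ (smash A).X ⊗ (smash B).X} (hx : IsBalanced (smash A) (smash B) x) :
    ∃ y, y ≫ (smashSplitHom A B).hom = x :=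
  have isEqualizer := (comulSplitIsSplitEqualizer A.X B.X).isEqualizer
  ⟨Fork.IsLimit.lift isEqualizer x hx.symm, Fork.IsLimit.lift_ι' isEqualizer x hx.symm⟩

instance isSplitMono_smashSplitHom : IsSplitMono (smashSplitHom A B).hom :=
  ⟨⟨counitMerge H A.X B.X, comulSplit_counitMerge A.X B.X⟩⟩

end SmashSplit

section CotensorDecomposition

variable {H : C} [BimonObj H] {S S' T T' : ComodAlg H} {A B : C}
  (t : A ⊗ T.X ⟶ S.X) (t' : B ⊗ T'.X ⟶ S'.X)

theorem tensorμ_tensorHom_coact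
    (ht : t ≫ S.coact = A ◁ T.coact ≫ (α_ A T.X H).inv ≫ t ▷ H) :
    (tensorμ A B T.X T'.X ≫ (t ⊗ₘ t')) ≫ S.coact ▷ S'.X =
      (A ⊗ B) ◁ T.coact ▷ T'.X ≫ tensorμ A B (T.X ⊗ H) T'.X ≫
        ((α_ A T.X H).inv ≫ t ▷ H ⊗ₘ t') := by
  rw [← tensorHom_id, ← tensorHom_id T.coact, tensorμ_natural_right_assoc, Category.assoc,
    tensorHom_comp_tensorHom, tensorHom_comp_tensorHom, ht, Category.comp_id, whiskerLeft_id,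
    Category.id_comp]

theorem tensorμ_tensorHom_leftCoact
    (ht' : t' ≫ S'.coact = B ◁ T'.coact ≫ (α_ B T'.X H).inv ≫ t' ▷ H) :
    (tensorμ A B T.X T'.X ≫ (t ⊗ₘ t')) ≫ S.X ◁ leftCoact S' ≫ (α_ S.X H S'.X).inv =
      (A ⊗ B) ◁ (T.X ◁ leftCoact T' ≫ (α_ T.X H T'.X).inv) ≫ tensorμ A B (T.X ⊗ H) T'.X ≫
        ((α_ A T.X H).inv ≫ t ▷ H ⊗ₘ t') := by
  have leftCoact_colinear : t' ≫ leftCoact S' = B ◁ leftCoact T' ≫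
      (α_ B H T'.X).inv ≫ (β_ B H).hom ▷ T'.X ≫ (α_ H B T'.X).hom ≫ H ◁ t' := by
    rw [leftCoact, leftCoact, reassoc_of% ht', BraidedCategory.braiding_naturality_left,
      BraidedCategory.braiding_tensor_left_hom]
    simp
  have tensor_leftCoact : (t ⊗ₘ t') ≫ S.X ◁ leftCoact S' = (A ⊗ T.X) ◁ B ◁ leftCoact T' ≫
      (A ⊗ T.X) ◁ ((α_ B H T'.X).inv ≫ (β_ B H).hom ▷ T'.X ≫ (α_ H B T'.X).hom) ≫
        (t ⊗ₘ (H ◁ t')) := by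
    rw [MonoidalCategory.tensorHom_def, Category.assoc, ← whiskerLeft_comp, leftCoact_colinear,
      MonoidalCategory.tensorHom_def t (H ◁ t'), whisker_exchange_assoc, whisker_exchange_assoc]
    simp only [whiskerLeft_comp, Category.assoc]
  have assoc_t : (t ⊗ₘ (H ◁ t')) ≫ (α_ S.X H S'.X).inv =
      (α_ (A ⊗ T.X) H (B ⊗ T'.X)).inv ≫ (t ▷ H ⊗ₘ t') := by
    rw [← id_tensorHom, associator_inv_naturality, tensorHom_id]
  have split_t : ((α_ A T.X H).inv ≫ t ▷ H ⊗ₘ t') =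
      (α_ A T.X H).inv ▷ (B ⊗ T'.X) ≫ (t ▷ H ⊗ₘ t') := by
    rw [← tensorHom_id (α_ A T.X H).inv, tensorHom_comp_tensorHom, Category.id_comp]
  rw [Category.assoc, reassoc_of% tensor_leftCoact, ← reassoc_of% tensorμ_natural_fourth,
    assoc_t, split_t]
  simp only [tensorμ, BraidedCategory.braiding_tensor_right_hom]
  monoidal

/-- If `S = A ⊗ T` and `S' = B ⊗ T'` as comodules, then `A ⊗ B ⊗ (T □ T')` is the cotensor product
of `S` and `S'`, because the flat object `A ⊗ B` preserves the defining equalizer. -/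
theorem isIso_of_cotensor [HLinearBraiding H] [HasEqualizers C] [IsFlat H] [IsFlat (A ⊗ B)]
    [IsIso t] [IsIso t']
    (ht : t ≫ S.coact = A ◁ T.coact ≫ (α_ A T.X H).inv ≫ t ▷ H)
    (ht' : t' ≫ S'.coact = B ◁ T'.coact ≫ (α_ B T'.X H).inv ≫ t' ▷ H)
    {U : C} {φ : U ⟶ S.X ⊗ S'.X} [Mono φ] (hφ : IsBalanced S S' φ)
    {θ : (A ⊗ B) ⊗ (cotensor T T').X ⟶ U}
    (hθ : θ ≫ φ = (A ⊗ B) ◁ (cotensorHom T T').hom ≫ tensorμ A B T.X T'.X ≫ (t ⊗ₘ t')) :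
    IsIso θ :=
  have := IsFlat.preserves (X := A ⊗ B)
  isIso_of_isLimit_fork
    (isLimitForkMapOfIsLimit (tensorLeft (A ⊗ B)) _ (cotensorHomIsEqualizer T T')) hφ
    (tensorμ_tensorHom_coact t t' ht) (tensorμ_tensorHom_leftCoact t t' ht') hθ

end CotensorDecomposition

/-! ### Centralizers in a tensor product -/

theorem mono_whiskerLeft_of_mono_whiskerRight {X Y : C} (f : X ⟶ Y) (Z : C) [Mono (f ▷ Z)] :
    Mono (Z ◁ f) := by
  have conjugate : Z ◁ f = (β_ Z X).hom ≫ f ▷ Z ≫ (β_ Z Y).inv := by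
    rw [← BraidedCategory.braiding_naturality_right_assoc, Iso.hom_inv_id, Category.comp_id]
  rw [conjugate]
  infer_instance

section TensorMultiplication

variable {A B S S' T T' : C} [MonObj S] [MonObj S'] (i : A ⟶ S) (i' : B ⟶ S')

theorem leftMul_tensorHom :
    leftMul (i ⊗ₘ i') = tensorμ A B S S' ≫ (leftMul i ⊗ₘ leftMul i') := by
  rw [leftMul, MonObj.tensorObj.mul_def, tensorμ_natural_left_assoc, tensorHom_comp_tensorHom,
    leftMul, leftMul]

theorem rightMul_tensorHom : rightMul (i ⊗ₘ i') =
    (β_ (A ⊗ B) (S ⊗ S')).hom ≫ tensorμ S S' A B ≫ (S ◁ i ≫ μ[S] ⊗ₘ S' ◁ i' ≫ μ[S']) := by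
  rw [rightMul, MonObj.tensorObj.mul_def, tensorμ_natural_right_assoc, tensorHom_comp_tensorHom]

theorem tensorμ_tensorHom_braiding (A B T T' : C) (hs : (β_ A T').hom ≫ (β_ T' A).hom = 𝟙 _) :
    tensorμ A B T T' ≫ ((β_ A T).hom ⊗ₘ (β_ B T').hom) =
      (β_ (A ⊗ B) (T ⊗ T')).hom ≫ tensorμ T T' A B := by
  have hs' : T ◁ (β_ A T').hom ▷ B ≫ T ◁ (β_ T' A).hom ▷ B = 𝟙 _ := by
    rw [← whiskerLeft_comp, ← comp_whiskerRight, hs, id_whiskerRight, whiskerLeft_id]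
  simp only [BraidedCategory.braiding_tensor_left_hom, BraidedCategory.braiding_tensor_right_hom,
    tensorμ, MonoidalCategory.tensorHom_def]
  simp [reassoc_of% hs']

variable {i i'} in
theorem Centralizes.tensorHom {j : T ⟶ S} {j' : T' ⟶ S'} (h : Centralizes i j)
    (h' : Centralizes i' j') (hs : (β_ A T').hom ≫ (β_ T' A).hom = 𝟙 _) :
    Centralizes (i ⊗ₘ i') (j ⊗ₘ j') := by
  rw [Centralizes] at h h' ⊢
  rw [leftMul_tensorHom, rightMul_tensorHom, BraidedCategory.braiding_naturality_right_assoc,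
    tensorμ_natural_right_assoc, tensorμ_natural_left_assoc,
    ← reassoc_of% tensorμ_tensorHom_braiding A B T T' hs, tensorHom_comp_tensorHom,
    tensorHom_comp_tensorHom, tensorHom_comp_tensorHom, h, h', rightMul, rightMul,
    BraidedCategory.braiding_naturality_right_assoc,
    BraidedCategory.braiding_naturality_right_assoc]

theorem leftMul_tensorHom_one :
    leftMul ((ρ_ A).inv ≫ (i ⊗ₘ η[S'])) = (α_ A S S').inv ≫ leftMul i ▷ S' := by
  have one_leftMul' : leftMul η[S'] = (λ_ S').hom := MonObj.one_mul S'
  rw [leftMul_precomp, leftMul_tensorHom, one_leftMul', MonoidalCategory.tensorHom_def']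
  simp only [tensorμ, braiding_tensorUnit_left]
  monoidal

theorem leftMul_one_tensorHom : leftMul ((λ_ B).inv ≫ (η[S] ⊗ₘ i')) =
    (α_ B S S').inv ≫ (β_ B S).hom ▷ S' ≫ (α_ S B S').hom ≫ S ◁ leftMul i' := by
  have one_leftMul' : leftMul η[S] = (λ_ S).hom := MonObj.one_mul S
  rw [leftMul_precomp, leftMul_tensorHom, one_leftMul', MonoidalCategory.tensorHom_def]
  simp only [tensorμ]
  monoidal

theorem rightMul_tensorHom_one : rightMul ((ρ_ A).inv ≫ (i ⊗ₘ η[S'])) =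
    (β_ A (S ⊗ S')).hom ≫ (α_ S S' A).hom ≫ S ◁ (β_ S' A).hom ≫ (α_ S A S').inv ≫
      (S ◁ i ≫ μ[S]) ▷ S' := by
  rw [rightMul_precomp, rightMul_tensorHom, MonObj.mul_one,
    BraidedCategory.braiding_naturality_left_assoc, MonoidalCategory.tensorHom_def']
  simp only [tensorμ]
  monoidal

theorem rightMul_one_tensorHom : rightMul ((λ_ B).inv ≫ (η[S] ⊗ₘ i')) =
    (α_ B S S').inv ≫ (β_ B S).hom ▷ S' ≫ (α_ S B S').hom ≫ S ◁ rightMul i' := by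
  rw [rightMul_precomp, rightMul_tensorHom, MonObj.mul_one,
    BraidedCategory.braiding_naturality_left_assoc, MonoidalCategory.tensorHom_def,
    BraidedCategory.braiding_tensor_right_hom, rightMul]
  simp only [tensorμ, braiding_tensorUnit_right]
  monoidal

theorem whiskerLeft_rightMul_tensorHom_one (j' : T' ⟶ S')
    (hs : (β_ A T').hom ≫ (β_ T' A).hom = 𝟙 _) :
    A ◁ S ◁ j' ≫ rightMul ((ρ_ A).inv ≫ (i ⊗ₘ η[S'])) =
      (α_ A S T').inv ≫ rightMul i ▷ T' ≫ S ◁ j' := by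
  rw [rightMul_tensorHom_one, BraidedCategory.braiding_naturality_right_assoc,
    associator_naturality_middle_assoc, ← whiskerLeft_comp_assoc,
    BraidedCategory.braiding_naturality_left, whiskerLeft_comp, Category.assoc,
    associator_inv_naturality_right_assoc, whisker_exchange,
    BraidedCategory.braiding_tensor_right_hom]
  simp only [Category.assoc, Iso.inv_hom_id_assoc]
  rw [← whiskerLeft_comp_assoc, hs, rightMul]
  simp

end TensorMultiplication

section FlatCentralizers

/-- The morphism `x : X ⟶ M ⊗ Z` centralizes `i : A ⟶ M` in the first tensor factor. -/
def CentralizesFst {A M X Z : C} [MonObj M] (i : A ⟶ M) (x : X ⟶ M ⊗ Z) : Prop :=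
  A ◁ x ≫ (α_ A M Z).inv ≫ leftMul i ▷ Z = A ◁ x ≫ (α_ A M Z).inv ≫ rightMul i ▷ Z

/-- A centralizer `j` of `i` is flat if it remains the centralizer of `i` after tensoring with any
flat object. -/
structure IsFlatCentralizer {A M T : C} [MonObj M] (i : A ⟶ M) (j : T ⟶ M) : Prop extends
    IsCentralizer i j where
  mono_whiskerRight (Z : C) [IsFlat Z] : Mono (j ▷ Z)
  exists_lift_whiskerRight {X Z : C} [IsFlat Z] (x : X ⟶ M ⊗ Z) (hx : CentralizesFst i x) :
    ∃ y, y ≫ j ▷ Z = x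

theorem IsFlatCentralizer.mono_tensorHom {A B S S' T T' : C} [MonObj S] [MonObj S'] {i : A ⟶ S}
    {i' : B ⟶ S'} {j : T ⟶ S} {j' : T' ⟶ S'} (h : IsFlatCentralizer i j)
    (h' : IsFlatCentralizer i' j') (H : C) [IsFlat H] [IsFlat S] [IsFlat T'] :
    Mono (j ▷ H ⊗ₘ j') := by
  have := IsFlat.tensor H T'
  have := IsFlat.tensor S H
  have := h.mono_whiskerRight (H ⊗ T')
  have := h'.mono_whiskerRight (S ⊗ H)
  have := mono_whiskerLeft_of_mono_whiskerRight j' (S ⊗ H)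
  rw [MonoidalCategory.tensorHom_def, whiskerRight_tensor_symm]
  infer_instance

variable {A B S S' T' X : C} [MonObj S] [MonObj S'] {i : A ⟶ S} {i' : B ⟶ S'}

theorem centralizes_one_tensorHom_iff (x : X ⟶ S ⊗ S') :
    Centralizes ((λ_ B).inv ≫ (η[S] ⊗ₘ i')) x ↔ CentralizesFst i' (x ≫ (β_ S' S).inv) := by
  have swap (t : B ⊗ S' ⟶ S') : B ◁ (x ≫ (β_ S' S).inv) ≫ (α_ B S' S).inv ≫ t ▷ S =
      (B ◁ x ≫ (α_ B S S').inv ≫ (β_ B S).hom ▷ S' ≫ (α_ S B S').hom ≫ S ◁ t) ≫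
        (β_ S' S).inv := by
    rw [Iso.eq_comp_inv]
    simp only [Category.assoc, BraidedCategory.braiding_naturality_left,
      BraidedCategory.braiding_tensor_left_hom, Iso.inv_hom_id_assoc, whiskerLeft_comp,
      whiskerLeft_inv_hom_assoc]
  rw [Centralizes, CentralizesFst, leftMul_one_tensorHom, rightMul_one_tensorHom, swap, swap,
    cancel_mono]

theorem centralizes_tensorHom_one_iff (y : X ⟶ S ⊗ T') (j' : T' ⟶ S') [Mono (S ◁ j')]
    (hs : (β_ A T').hom ≫ (β_ T' A).hom = 𝟙 _) :
    Centralizes ((ρ_ A).inv ≫ (i ⊗ₘ η[S'])) (y ≫ S ◁ j') ↔ CentralizesFst i y := by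
  have left : A ◁ S ◁ j' ≫ leftMul ((ρ_ A).inv ≫ (i ⊗ₘ η[S'])) =
      (α_ A S T').inv ≫ leftMul i ▷ T' ≫ S ◁ j' := by
    rw [leftMul_tensorHom_one, associator_inv_naturality_right_assoc, whisker_exchange]
  rw [Centralizes, CentralizesFst, whiskerLeft_comp, Category.assoc, Category.assoc, left,
    whiskerLeft_rightMul_tensorHom_one i j' hs, ← cancel_mono (S ◁ j')]
  simp only [Category.assoc]

variable [MonObj A] [MonObj B] [IsMonHom i] [IsMonHom i'] {T : C} {j : T ⟶ S} {j' : T' ⟶ S'}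

theorem IsFlatCentralizer.tensorHom [IsFlat S] [IsFlat T'] (h : IsFlatCentralizer i j)
    (h' : IsFlatCentralizer i' j') (hs : (β_ A T').hom ≫ (β_ T' A).hom = 𝟙 _) :
    IsCentralizer (i ⊗ₘ i') (j ⊗ₘ j') := by
  have := h.mono_whiskerRight T'
  have := h'.mono_whiskerRight S
  have := mono_whiskerLeft_of_mono_whiskerRight j' S
  have fst_eq : (ρ_ A).inv ≫ (i ⊗ₘ η[S']) = ((ρ_ A).inv ≫ A ◁ η[B]) ≫ (i ⊗ₘ i') := by
    rw [← id_tensorHom, Category.assoc, tensorHom_comp_tensorHom, IsMonHom.one_hom,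
      Category.id_comp]
  have snd_eq : (λ_ B).inv ≫ (η[S] ⊗ₘ i') = ((λ_ B).inv ≫ η[A] ▷ B) ≫ (i ⊗ₘ i') := by
    rw [← tensorHom_id, Category.assoc, tensorHom_comp_tensorHom, IsMonHom.one_hom,
      Category.id_comp]
  refine ⟨by rw [MonoidalCategory.tensorHom_def]; infer_instance,
    h.centralizes.tensorHom h'.centralizes hs, fun x hx => ?_⟩
  obtain ⟨y, hy⟩ : ∃ y, y ≫ S ◁ j' = x := by
    obtain ⟨y, hy⟩ := h'.exists_lift_whiskerRight _
      ((centralizes_one_tensorHom_iff x).1 (snd_eq ▸ hx.precomp_left _))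
    refine ⟨y ≫ (β_ T' S).hom, ?_⟩
    rw [Category.assoc, ← BraidedCategory.braiding_naturality_left, reassoc_of% hy,
      Iso.inv_hom_id, Category.comp_id]
  obtain ⟨z, hz⟩ := h.exists_lift_whiskerRight y
    ((centralizes_tensorHom_one_iff y j' hs).1 (hy ▸ fst_eq ▸ hx.precomp_left _))
  exact ⟨z, by rw [MonoidalCategory.tensorHom_def, reassoc_of% hz, hy]⟩

end FlatCentralizers

section Curry

variable [MonoidalClosed C] {A M X : C} [MonObj M] {i : A ⟶ M}

theorem centralizes_iff_curry (x : X ⟶ M) : Centralizes i x ↔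
    x ≫ MonoidalClosed.curry (leftMul i) = x ≫ MonoidalClosed.curry (rightMul i) := by
  rw [← MonoidalClosed.curry_natural_left, ← MonoidalClosed.curry_natural_left,
    MonoidalClosed.curry_injective.eq_iff, Centralizes]

theorem CentralizesFst.comp_curry {Z : C} {x : X ⟶ M ⊗ Z}
    (hA : IsFinite A) (hx : CentralizesFst i x) :
    x ≫ MonoidalClosed.curry (leftMul i) ▷ Z = x ≫ MonoidalClosed.curry (rightMul i) ▷ Z := by
  have curry_ev (t : A ⊗ M ⟶ M) : A ◁ (MonoidalClosed.curry t) ▷ Z ≫ (α_ A _ Z).inv ≫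
      (ihom.ev A).app M ▷ Z = (α_ A M Z).inv ≫ t ▷ Z := by
    rw [associator_inv_naturality_middle_assoc, ← comp_whiskerRight,
      ← MonoidalClosed.uncurry_eq, MonoidalClosed.uncurry_curry]
  -- `[A, M] ⊗ Z` is `[A, M ⊗ Z]` because `A` is finite.
  apply curry_cancel hA
  rw [whiskerLeft_comp, whiskerLeft_comp, Category.assoc, Category.assoc, curry_ev, curry_ev, hx]

end Curry

section Commutant

variable [HasEqualizers C] [MonoidalClosed C] {H : C} [BimonObj H] [IsFlat H] [HLinearBraiding H]
  (M : ComodAlg H) {A : C} (hA : IsFinite A) (i : A ⟶ M.X)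
  (hi : i ≫ M.coact = (ρ_ A).inv ≫ (i ⊗ₘ η[H]))

/-- The inclusion of the commutant. -/
noncomputable def commutantHom : commutant M hA i hi ⟶ M where
  hom := equalizer.ι (MonoidalClosed.curry (leftMul i)) (MonoidalClosed.curry (rightMul i))
  isMonHom :=
    { one_hom := equalizer.lift_ι _ _
      mul_hom := equalizer.lift_ι _ _ }
  colinear := Fork.IsLimit.lift_ι' (equalizerTensor (H := H) _ _) _ _

theorem isFlatCentralizer_commutantHom : IsFlatCentralizer i (commutantHom M hA i hi).hom where
  mono := inferInstanceAs (Mono (equalizer.ι _ _))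
  centralizes := (centralizes_iff_curry _).2 (equalizer.condition _ _)
  exists_lift x hx :=
    ⟨equalizer.lift x ((centralizes_iff_curry x).1 hx), equalizer.lift_ι _ _⟩
  mono_whiskerRight _ := mono_tensor _ _
  exists_lift_whiskerRight _ hx :=
    ⟨Fork.IsLimit.lift (equalizerTensor (MonoidalClosed.curry (leftMul i))
      (MonoidalClosed.curry (rightMul i))) _ (hx.comp_curry hA), Fork.IsLimit.lift_ι' _ _ _⟩

end Commutant

/-! ### The commutants in the smash products -/

section ComodAlgIso

variable {H : C} [BimonObj H] {M S T : ComodAlg H}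

instance isIso_comodAlgHom_hom (f : S ⟶ T) [IsIso f] : IsIso f.hom :=
  ⟨(inv f).hom, congrArg ComodAlg.Hom.hom (IsIso.hom_inv_id f),
    congrArg ComodAlg.Hom.hom (IsIso.inv_hom_id f)⟩

theorem exists_comodAlgHom_of_comp_eq {f : S ⟶ M} {g : T ⟶ M} [Mono g.hom] [Mono (g.hom ▷ H)]
    {u : S.X ⟶ T.X} (hu : u ≫ g.hom = f.hom) : ∃ e : S ⟶ T, e.hom = u :=
  ⟨{ hom := u
     isMonHom :=
      { one_hom := by
          rw [← cancel_mono g.hom, Category.assoc, hu, IsMonHom.one_hom, IsMonHom.one_hom]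
        mul_hom := by
          rw [← cancel_mono g.hom, Category.assoc, Category.assoc, hu, IsMonHom.mul_hom,
            IsMonHom.mul_hom, tensorHom_comp_tensorHom_assoc, hu] }
     colinear := by
      rw [← cancel_mono (g.hom ▷ H), Category.assoc, Category.assoc, g.colinear,
        ← comp_whiskerRight, hu, f.colinear, reassoc_of% hu] }, rfl⟩

theorem IsCentralizer.exists_comodAlgIso {A : C} {i : A ⟶ M.X} {f : S ⟶ M} {g : T ⟶ M}
    (hf : IsCentralizer i f.hom) (hg : IsCentralizer i g.hom) [Mono (g.hom ▷ H)] :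
    ∃ e : S ≅ T, e.hom ≫ g = f := by
  obtain ⟨u, hu⟩ := hg.exists_lift f.hom hf.centralizes
  obtain ⟨v, hv⟩ := hf.exists_lift g.hom hg.centralizes
  have := hf.mono
  have := hg.mono
  have hom_inv : u ≫ v = 𝟙 _ := by
    rw [← cancel_mono f.hom, Category.assoc, hv, hu, Category.id_comp]
  have inv_hom : v ≫ u = 𝟙 _ := by
    rw [← cancel_mono g.hom, Category.assoc, hu, hv, Category.id_comp]
  have : IsIso u := ⟨v, hom_inv, inv_hom⟩
  have : Mono (f.hom ▷ H) := by
    rw [← hu, comp_whiskerRight]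
    infer_instance
  obtain ⟨a, rfl⟩ := exists_comodAlgHom_of_comp_eq hu
  obtain ⟨b, rfl⟩ := exists_comodAlgHom_of_comp_eq hv
  exact ⟨⟨a, b, ComodAlg.Hom.ext hom_inv, ComodAlg.Hom.ext inv_hom⟩, ComodAlg.Hom.ext hu⟩

theorem isIso_leftMul_comp {A : C} (i : A ⟶ M.X) (e : S ⟶ T) (f : T ⟶ M) [IsIso e]
    [IsIso (A ◁ f.hom ≫ leftMul i)] : IsIso (A ◁ (e ≫ f).hom ≫ leftMul i) := by
  have comp_eq : A ◁ (e ≫ f).hom ≫ leftMul i = A ◁ e.hom ≫ A ◁ f.hom ≫ leftMul i :=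
    whiskerLeft_comp_assoc A e.hom f.hom (leftMul i)
  rw [comp_eq]
  infer_instance

theorem leftMul_hom_coact [HLinearBraiding H] {A : C} {i : A ⟶ M.X}
    (hi : i ≫ M.coact = (ρ_ A).inv ≫ (i ⊗ₘ η[H])) (f : T ⟶ M) : (A ◁ f.hom ≫ leftMul i) ≫ M.coact =
      A ◁ T.coact ≫ (α_ A T.X H).inv ≫ (A ◁ f.hom ≫ leftMul i) ▷ H := by
  rw [Category.assoc, leftMul_coact M _ hi, ← whiskerLeft_comp_assoc, ← f.colinear,
    comp_whiskerRight, whiskerLeft_comp, Category.assoc, associator_inv_naturality_middle_assoc]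

end ComodAlgIso

section CotensorLift

variable {H : C} [BimonObj H] [HLinearBraiding H] {A B : Mod C H} [MonObj A] [MonObj B]

theorem leftMul_smashIncl_comp_smashSplitHom {X : C} (x : X ⟶ (smash (A ⊗ B)).X) :
    ((A ⊗ B).X ◁ x ≫ leftMul (smashIncl (A ⊗ B))) ≫ (smashSplitHom A B).hom =
      (A.X ⊗ B.X) ◁ (x ≫ (smashSplitHom A B).hom) ≫ leftMul (smashIncl A ⊗ₘ smashIncl B) := by
  rw [Category.assoc, ← leftMul_postcomp, smashIncl_smashSplitHom, ← whiskerLeft_comp_assoc]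
  rfl

variable [HasEqualizers C] [IsFlat H] {T T' : ComodAlg H}

theorem exists_cotensor_hom_comp_smashSplitHom (f : T ⟶ smash A) (g : T' ⟶ smash B) :
    ∃ k : cotensor T T' ⟶ smash (A ⊗ B),
      k.hom ≫ (smashSplitHom A B).hom = (cotensorHom T T').hom ≫ (f.hom ⊗ₘ g.hom) := by
  have isBalanced :
      IsBalanced (smash A) (smash B) ((cotensorHom T T').hom ≫ (f.hom ⊗ₘ g.hom)) := by
    rw [IsBalanced, Category.assoc, Category.assoc, tensorHom_coact, tensorHom_leftCoact,
      reassoc_of% isBalanced_cotensorHom T T', Category.assoc]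
  obtain ⟨u, hu⟩ := isBalanced.exists_lift_smashSplitHom
  have : Mono ((smashSplitHom A B).hom ▷ H) :=
    inferInstanceAs (Mono ((tensorRight H).map (smashSplitHom A B).hom))
  obtain ⟨k, rfl⟩ := exists_comodAlgHom_of_comp_eq
    (f := cotensorHom T T' ≫ tensorComodAlgHom f g) (g := smashSplitHom A B) hu
  exact ⟨k, hu⟩

variable {f : T ⟶ smash A} {g : T' ⟶ smash B} {k : cotensor T T' ⟶ smash (A ⊗ B)}

theorem IsCentralizer.of_cotensor [Mono (f.hom ▷ H ⊗ₘ g.hom)]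
    (h : IsCentralizer (smashIncl A ⊗ₘ smashIncl B) (f.hom ⊗ₘ g.hom))
    (hk : k.hom ≫ (smashSplitHom A B).hom = (cotensorHom T T').hom ≫ (f.hom ⊗ₘ g.hom)) :
    IsCentralizer (smashIncl (A ⊗ B)) k.hom where
  mono :=
    have := h.mono
    mono_of_mono_fac hk
  centralizes := by
    rw [← centralizes_postcomp_iff _ _ (smashSplitHom A B).hom, smashIncl_smashSplitHom, hk]
    exact h.centralizes.precomp_right _
  exists_lift x hx := by
    rw [← centralizes_postcomp_iff _ _ (smashSplitHom A B).hom, smashIncl_smashSplitHom] at hx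
    obtain ⟨y, hy⟩ := h.exists_lift _ hx
    have isBalanced : IsBalanced T T' y := by
      rw [← isBalanced_tensorHom_iff f g, hy]
      exact (isBalanced_smashSplitHom A B).precomp x
    obtain ⟨z, rfl⟩ := isBalanced.exists_lift_cotensorHom
    refine ⟨z, ?_⟩
    rw [← cancel_mono (smashSplitHom A B).hom, Category.assoc, hk, ← hy, Category.assoc]

theorem isIso_leftMul_of_cotensor [IsFlat A.X] [IsFlat B.X]
    [IsIso (A.X ◁ f.hom ≫ leftMul (smashIncl A))] [IsIso (B.X ◁ g.hom ≫ leftMul (smashIncl B))]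
    (hk : k.hom ≫ (smashSplitHom A B).hom = (cotensorHom T T').hom ≫ (f.hom ⊗ₘ g.hom)) :
    IsIso ((A ⊗ B).X ◁ k.hom ≫ leftMul (smashIncl (A ⊗ B))) := by
  have := IsFlat.tensor A.X B.X
  refine isIso_of_cotensor (A.X ◁ f.hom ≫ leftMul (smashIncl A))
    (B.X ◁ g.hom ≫ leftMul (smashIncl B)) (leftMul_hom_coact (smashIncl_coact A) f)
    (leftMul_hom_coact (smashIncl_coact B) g) (isBalanced_smashSplitHom A B) ?_
  refine (leftMul_smashIncl_comp_smashSplitHom k.hom).trans ?_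
  rw [hk, leftMul_tensorHom, whiskerLeft_comp, Category.assoc, tensorμ_natural_right_assoc,
    tensorHom_comp_tensorHom]

end CotensorLift

section SmashCommutant

variable [HasEqualizers C] [MonoidalClosed C]

section Inclusion

variable {H : C} [BimonObj H] [IsFlat H] [HLinearBraiding H] (A : Mod C H) [MonObj A]
  (hA : IsFinite A.X)

/-- The inclusion of `(A # H)^A` into `A # H`. -/
noncomputable def smashCommutantHom : smashCommutant A hA ⟶ smash A :=
  commutantHom (smash A) hA (smashIncl A) (smashIncl_coact A)

theorem isFlatCentralizer_smashCommutantHom :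
    IsFlatCentralizer (smashIncl A) (smashCommutantHom A hA).hom :=
  isFlatCentralizer_commutantHom _ _ _ _

end Inclusion

variable {H : C} [HopfObj H] [IsFlat H] [HLinearBraiding H] {A B : Mod C H} [MonObj A] [MonObj B]

theorem IsLeftAzumaya.isIso_leftMul_smashCommutantHom (hA : IsLeftAzumaya A.X) :
    IsIso (A.X ◁ (smashCommutantHom A hA.isFinite).hom ≫ leftMul (smashIncl A)) :=
  have ⟨P, _, _⟩ := hA.exists_isIso
  (isFlatCentralizer_smashCommutantHom A hA.isFinite).isIso_leftMul P

theorem IsLeftAzumaya.isGaloisObj_smashCommutant (hA : IsLeftAzumaya A.X) :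
    IsGaloisObj (smashCommutant A hA.isFinite) :=
  have := hA.isFlat
  have := hA.reflectsIsomorphisms
  have := hA.isIso_leftMul_smashCommutantHom
  isGaloisObj_of_smash A (smashCommutantHom A hA.isFinite)

theorem IsLeftAzumaya.exists_cotensor_isCentralizer (hA : IsLeftAzumaya A.X)
    (hB : IsLeftAzumaya B.X) (hs : (β_ A.X (smashCommutant B hB.isFinite).X).hom ≫
      (β_ (smashCommutant B hB.isFinite).X A.X).hom = 𝟙 _) :
    ∃ k : cotensor (smashCommutant A hA.isFinite) (smashCommutant B hB.isFinite) ⟶ smash (A ⊗ B),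
      IsCentralizer (smashIncl (A ⊗ B)) k.hom ∧
        IsIso ((A ⊗ B).X ◁ k.hom ≫ leftMul (smashIncl (A ⊗ B))) := by
  have := hA.isFlat
  have := hB.isFlat
  have := hA.isIso_leftMul_smashCommutantHom
  have := hB.isIso_leftMul_smashCommutantHom
  have : IsFlat (smash A).X := IsFlat.tensor A.X H
  have := hB.isGaloisObj_smashCommutant.faithfullyFlat
  have centralizerA := isFlatCentralizer_smashCommutantHom A hA.isFinite
  have centralizerB := isFlatCentralizer_smashCommutantHom B hB.isFinite
  have := centralizerA.mono_tensorHom centralizerB H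
  obtain ⟨k, hk⟩ := exists_cotensor_hom_comp_smashSplitHom
    (smashCommutantHom A hA.isFinite) (smashCommutantHom B hB.isFinite)
  exact ⟨k, (centralizerA.tensorHom centralizerB hs).of_cotensor hk, isIso_leftMul_of_cotensor hk⟩

end SmashCommutant

end BraidedHopf

theorem mainTheorem4_general
    {C : Type u} [Category.{v} C] [MonoidalCategory C] [BraidedCategory C] [MonoidalClosed C]
    [HasEqualizers C] {H : C} [HopfObj H] [IsFlat H] [HLinearBraiding H]
    {A B : Mod C H} [MonObj A] [MonObj B] (hA : IsLeftAzumaya A.X) (hB : IsLeftAzumaya B.X)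
    (hs : (β_ A.X (smashCommutant B hB.isFinite).X).hom ≫
      (β_ (smashCommutant B hB.isFinite).X A.X).hom = 𝟙 _) :
    IsGaloisObj (smashCommutant (A ⊗ B) (hA.isFinite.tensor hB.isFinite)) ∧
      IsGaloisObj (cotensor (smashCommutant A hA.isFinite) (smashCommutant B hB.isFinite)) ∧
      Nonempty (smashCommutant (A ⊗ B) (hA.isFinite.tensor hB.isFinite) ≅
        cotensor (smashCommutant A hA.isFinite) (smashCommutant B hB.isFinite)) := by
  have := hA.isFlat
  have := hB.isFlat
  have := hA.reflectsIsomorphisms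
  have := hB.reflectsIsomorphisms
  have : IsFlat (A ⊗ B).X := IsFlat.tensor A.X B.X
  have : (tensorLeft (A ⊗ B).X).ReflectsIsomorphisms :=
    tensorLeft_tensor_reflectsIsomorphisms A.X B.X
  obtain ⟨k, centralizer_k, _⟩ := hA.exists_cotensor_isCentralizer hB hs
  have centralizerAB :=
    isFlatCentralizer_smashCommutantHom (A ⊗ B) (hA.isFinite.tensor hB.isFinite)
  have := centralizerAB.mono_whiskerRight H
  obtain ⟨e, -⟩ := centralizer_k.exists_comodAlgIso centralizerAB.toIsCentralizer
  have := isIso_leftMul_comp (smashIncl (A ⊗ B)) e.inv k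
  exact ⟨isGaloisObj_of_smash (A ⊗ B) (e.inv ≫ k), isGaloisObj_of_smash (A ⊗ B) k, ⟨e.symm⟩⟩

theorem mainTheorem4
    {C : Type u} [Category.{v} C] [MonoidalCategory C] [BraidedCategory C] [MonoidalClosed C]
    [HasEqualizers C] [HasCoequalizers C]
    (H : C) [HopfObj H] [IsFlat H] [HLinearBraiding H]
    (hsymm : ∀ T : ComodAlg H, IsGaloisObj T → ∀ X : C, (β_ T.X X).hom = (β_ X T.X).inv)
    (A B : Mod C H) [MonObj A] [MonObj B] (hA : IsAzumayaAlg A) (hB : IsAzumayaAlg B) :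
    IsGaloisObj (smashCommutant (A ⊗ B) (hA.isFinite_tensor hB)) ∧
      IsGaloisObj (cotensor (smashCommutant A hA.isFinite) (smashCommutant B hB.isFinite)) ∧
      Nonempty (smashCommutant (A ⊗ B) (hA.isFinite_tensor hB) ≅
        cotensor (smashCommutant A hA.isFinite) (smashCommutant B hB.isFinite)) := by
  refine mainTheorem4_general hA.isLeftAzumaya hB.isLeftAzumaya ?_
  rw [hsymm _ hB.isLeftAzumaya.isGaloisObj_smashCommutant A.X, Iso.hom_inv_id]
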